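/- Let $k$ be an infinite field and let $H\subseteq\mathbb{N}$ be a numerical semigroup (a submonoid of $(\mathbb N,+)$ with finite complement), written in increasing order as $H=\{a_0=0<a_1<a_2<\cdots\}$. Let $n$ be the least integer such that $a_{n+i}=a_n+i$ for all $i\ge 0$, and suppose that $n=4$. Let $R=k[[H]]=k[[t^h\mid h\in H]]\subseteq k[[t]]$, let $Q(R)$ be its field of fractions, $\overline{R}$ the integral closure of $R$ in $Q(R)$, and $\mathfrak{c}=R:\overline{R}=\{x\in Q(R)\mid x\overline{R}\subseteq R\}$ the conductor. An $R$-module $M$ is reflexive if the canonical map $M\to\operatorname{Hom}_R(\operatorname{Hom}_R(M,R),R)$ is an isomorphism; $\mathrm{Ref}_1(R)$ denotes the set of isomorphism classes of reflexive $R$-modules of rank one. An ideal $I$ of $R$ is reflexive if $R:(R:I)=I$, where colons are taken in $Q(R)$. An ideal of $R$ is a trace ideal if it is of the form $\sum_{f\in\operatorname{Hom}_R(M,R)}\operatorname{Im} f$ for some $R$-module $M$; $\mathrm{T}(R)$ denotes the set of nonzero trace ideals of $R$. An ideal of $R$ is monomial if it is generated by elements $t^h$ with $h\in H$. Then the following conditions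 are equivalent: 1. every reflexive $R$-module of rank one is isomorphic to a monomial ideal of $R$ containing $\mathfrak{c}$; 2. $\mathrm{Ref}_1(R)$ is finite; 3. the set of reflexive ideals in $\mathrm{T}(R)$ is finite; 4. either (i) $a_2-a_1+a_3\ge a_4$, or (ii) $2a_3-a_1<a_4$. Moreover, condition (i) holds if and only if $\mathrm{T}(R)$ is finite. -/

import Mathlib

open scoped PowerSeries

universe u

noncomputable section

/-! ### Numerical semigroups -/

/-- `semigroupElt H i` is `a_i`, where `H = {a_0 = 0 < a_1 < a_2 < ⋯}` is the increasing
enumeration of an infinite submonoid of `ℕ`. -/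
def semigroupElt (H : AddSubmonoid ℕ) (i : ℕ) : ℕ := Nat.nth (· ∈ H) i

/-- The least `n` such that `a_{n+i} = a_n + i` for all `i ≥ 0` (such an `n` exists as soon as
`ℕ \ H` is finite). -/
def semigroupIndex (H : AddSubmonoid ℕ) : ℕ :=
  sInf {n : ℕ | ∀ i : ℕ, semigroupElt H (n + i) = semigroupElt H n + i}

/-- The semigroup ring `k[[H]]`: the `k`-subalgebra of `k[[t]]` of all power series whose
exponents lie in `H`. -/
def semigroupRing (k : Type u) [Field k] (H : AddSubmonoid ℕ) : Subalgebra k k⟦X⟧ where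
  carrier := {f | ∀ m : ℕ, m ∉ H → PowerSeries.coeff m f = 0}
  mul_mem' := by
    intro f g hf hg m hm
    rw [PowerSeries.coeff_mul]
    refine Finset.sum_eq_zero fun p hp => ?_
    by_cases h1 : p.1 ∈ H
    · by_cases h2 : p.2 ∈ H
      · exact absurd (Finset.HasAntidiagonal.mem_antidiagonal.1 hp ▸ H.add_mem h1 h2) hm
      · rw [hg _ h2, mul_zero]
    · rw [hf _ h1, zero_mul]
  add_mem' := by
    intro f g hf hg m hm
    rw [map_add, hf m hm, hg m hm, add_zero]
  algebraMap_mem' := by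
    intro c m hm
    have h0 : m ≠ 0 := fun h => hm (h ▸ H.zero_mem)
    rw [PowerSeries.algebraMap_apply, PowerSeries.coeff_C, if_neg h0]

/-- An ideal of `k[[H]]` is monomial if it is generated by monomials `t^h` with `h ∈ H`. -/
def IsMonomialIdeal {k : Type u} [Field k] {H : AddSubmonoid ℕ}
    (I : Ideal (semigroupRing k H)) : Prop :=
  ∃ S : Set ℕ, S ⊆ (H : Set ℕ) ∧
    I = Ideal.span {f : semigroupRing k H | ∃ h ∈ S, (f : k⟦X⟧) = PowerSeries.X ^ h}

/-! ### Conductor, trace ideals, reflexive modules -/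

section General

variable (R : Type u) [CommRing R]

/-- The conductor `R : R̄` in the total ring of fractions `Q(R)`, where `R̄` is the integral closure
of `R` in `Q(R)`. It is contained in `R`, and is given here as an ideal of `R`. -/
def conductorIdeal : Ideal R :=
  Submodule.comap (Algebra.linearMap R (FractionRing R))
    ((1 : Submodule R (FractionRing R)) /
      Subalgebra.toSubmodule (integralClosure R (FractionRing R)))

/-- The trace of a module: the sum of the images of all linear maps `M → R`. -/
def traceOfModule (M : Type u) [AddCommGroup M] [Module R M] : Ideal R :=
  ⨆ f : M →ₗ[R] R, LinearMap.range f

/-- `T(R)`: the set of trace ideals of `R` that contain a non-zero-divisor. -/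
def regularTraceIdeals : Set (Ideal R) :=
  {I | (∃ x ∈ I, x ∈ nonZeroDivisors R) ∧
    ∃ (M : Type u) (_ : AddCommGroup M) (_ : Module R M), I = traceOfModule R M}

variable {R} in
/-- An ideal `I` is reflexive if `R : (R : I) = I`, the colons being taken in `Q(R)`. -/
def IsReflexiveIdeal (I : Ideal R) : Prop :=
  (1 : Submodule R (FractionRing R)) / (1 / IsLocalization.coeSubmodule (FractionRing R) I) =
    IsLocalization.coeSubmodule (FractionRing R) I

/-- The set of reflexive ideals in `T(R)`. -/
def reflexiveTraceIdeals : Set (Ideal R) :=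
  {I | I ∈ regularTraceIdeals R ∧ IsReflexiveIdeal I}

/-- A reflexive module of rank one (over a domain `R`): the canonical map to the double dual is
an isomorphism, and the maximal cardinality of an `R`-linearly independent family is one. -/
def IsRankOneReflexive (M : Type u) [AddCommGroup M] [Module R M] : Prop :=
  Module.IsReflexive R M ∧ Module.rank R M = 1

/-- `Ref₁(R)`: the set of isomorphism classes of reflexive `R`-modules of rank one. -/
def rankOneReflexiveClasses :
    Set (Quotient (CategoryTheory.isIsomorphicSetoid (ModuleCat.{u} R))) :=
  {c | ∃ M : ModuleCat.{u} R, IsRankOneReflexive R M ∧ Quotient.mk _ M = c}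

end General

end

open PowerSeries

variable {k : Type u} [Field k] {H : AddSubmonoid ℕ}

/-! Write `H = {0, a, b, d, c, c + 1, …}` with `c - 1 ∉ H`. The argument takes place in `k⟦X⟧`. The
ideals that matter contain the tail `X ^ c k⟦X⟧`, so each is determined by the coefficients of its
elements at `0, a, b, d`, and `R : I` consists of power series `f`, subject to one linear equation
for every gap of `H` and every element of `I`.

Dividing a rank one reflexive module by a functional of least order turns it into such an ideal,
equal to its double colon (`exists_ideal_of_isRankOneReflexive`). Nonzero trace ideals are likewise
ideals containing the tail, stable under `R : I` (`isColonStable_of_mem_regularTraceIdeals`).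

Suppose `I` is reflexive, is not `R`, and has an element of order `a`. Under (i), `X ^ d` lies in
`I`; dividing by the unit `1 + x X ^ (b - a)` then makes `I` monomial, since `b - a + d ≥ c` leaves
`X ^ d` unchanged modulo the tail. Under (ii), the gap equations are strong enough to force `I` to
be monomial, or principal modulo the tail, or, for an arithmetic progression `a, b, d`, a unit times
`(X ^ a, X ^ b)` modulo the tail (`exists_monomialIdeal_equiv_of_isColonReflexive`). Only finitely
many monomial ideals contain the conductor, and isomorphic trace ideals are equal, so finiteness
passes from classes of modules to reflexive trace ideals.

If (i) fails, the ideals `f_0 = 0, f_b = x f_a`, one for each `x` in the infinite field, are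
distinct trace ideals (`slantIdeal`). If (ii) fails too, they are all reflexive. Under (i),
stability under `R : I` makes every nonzero trace ideal monomial, so there are finitely many. -/

/-- `c` is the exponent of the conductor of `k⟦H⟧`: all `m ≥ c` lie in `H`, but `c - 1` does not. -/
structure IsConductorExponent (H : AddSubmonoid ℕ) (c : ℕ) : Prop where
  mem_of_le : ∀ m, c ≤ m → m ∈ H
  pred_notMem : ∃ m, m + 1 = c ∧ m ∉ H

/-! ### Ideals of `k⟦H⟧` as sets of power series -/

/-- An ideal of `k⟦H⟧`, viewed inside `k⟦X⟧`. -/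
noncomputable def Ideal.toSeries (I : Ideal (semigroupRing k H)) : Submodule (semigroupRing k H) k⟦X⟧ :=
  Submodule.map (Algebra.linearMap (semigroupRing k H) k⟦X⟧) I

theorem Ideal.mem_toSeries {I : Ideal (semigroupRing k H)} {v : k⟦X⟧} :
    v ∈ I.toSeries ↔ ∃ hv : v ∈ semigroupRing k H, (⟨v, hv⟩ : semigroupRing k H) ∈ I := by
  constructor
  · rintro ⟨r, hr, rfl⟩
    exact ⟨r.2, hr⟩
  · rintro ⟨hv, h⟩
    exact ⟨_, h, rfl⟩

theorem Ideal.coe_mem_toSeries {I : Ideal (semigroupRing k H)} {r : semigroupRing k H} :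
    (r : k⟦X⟧) ∈ I.toSeries ↔ r ∈ I := by
  rw [Ideal.mem_toSeries]
  exact ⟨fun ⟨_, h⟩ => h, fun h => ⟨r.2, h⟩⟩

theorem Ideal.mem_semigroupRing_of_mem_toSeries {I : Ideal (semigroupRing k H)} {v : k⟦X⟧}
    (hv : v ∈ I.toSeries) : v ∈ semigroupRing k H :=
  (Ideal.mem_toSeries.1 hv).1

theorem Ideal.mul_mem_toSeries {I : Ideal (semigroupRing k H)} {r v : k⟦X⟧}
    (hr : r ∈ semigroupRing k H) (hv : v ∈ I.toSeries) : r * v ∈ I.toSeries :=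
  I.toSeries.smul_mem (⟨r, hr⟩ : semigroupRing k H) hv

theorem C_mem_semigroupRing (x : k) : (C x : k⟦X⟧) ∈ semigroupRing k H :=
  (semigroupRing k H).algebraMap_mem x

theorem X_pow_mem_semigroupRing {m : ℕ} (hm : m ∈ H) :
    (X ^ m : k⟦X⟧) ∈ semigroupRing k H := by
  intro n hn
  rw [coeff_X_pow, if_neg]
  rintro rfl
  exact hn hm

/-- The ideal `I` of `k⟦H⟧` contains all multiples of `X ^ c` in `k⟦X⟧`. -/
def ContainsTail (c : ℕ) (I : Ideal (semigroupRing k H)) : Prop :=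
  ∀ v : k⟦X⟧, X ^ c ∣ v → v ∈ I.toSeries

/-- `R : (R : I) ⊆ I`, with the colons taken in `k⟦X⟧`. -/
def IsColonReflexive (I : Ideal (semigroupRing k H)) : Prop :=
  ∀ g : k⟦X⟧, (∀ f : k⟦X⟧, (∀ y ∈ I.toSeries, f * y ∈ semigroupRing k H) →
    f * g ∈ semigroupRing k H) → g ∈ I.toSeries

/-- `I` is stable under multiplication by `R : I`, the colon being taken in `k⟦X⟧`. -/
def IsColonStable (I : Ideal (semigroupRing k H)) : Prop :=
  ∀ f : k⟦X⟧, (∀ y ∈ I.toSeries, f * y ∈ semigroupRing k H) →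
    ∀ y ∈ I.toSeries, f * y ∈ I.toSeries

theorem PowerSeries.dvd_of_X_pow_dvd {n : ℕ} {p g : k⟦X⟧} (hp : X ^ n ∣ p) (hg : X ^ n ∣ g)
    (hgn : coeff n g ≠ 0) : g ∣ p := by
  obtain ⟨q, rfl⟩ := hg
  obtain ⟨r, rfl⟩ := hp
  have hq : IsUnit q := by
    rw [PowerSeries.isUnit_iff_constantCoeff]
    have : coeff n (X ^ n * q) = constantCoeff q := by
      rw [coeff_X_pow_mul', if_pos le_rfl, Nat.sub_self, coeff_zero_eq_constantCoeff_apply]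
    rw [← this]
    exact isUnit_iff_ne_zero.2 hgn
  exact mul_dvd_mul_left _ (hq.dvd)

/-- At a gap `m`, a term `f_i g_j` of the product with `j ∈ H` has `i ∉ H`, as otherwise `m = i + j`
would lie in `H`. By induction only `f_m g_0` survives. -/
theorem mem_of_mul_mem_of_coeff_zero_ne_zero {f g : k⟦X⟧} (hg : g ∈ semigroupRing k H)
    (hg0 : coeff 0 g ≠ 0) (hfg : f * g ∈ semigroupRing k H) : f ∈ semigroupRing k H := by
  intro m
  induction m using Nat.strong_induction_on with
  | _ m ih =>
    intro hm
    have h := hfg m hm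
    rw [coeff_mul, Finset.sum_eq_single (m, 0)] at h
    · exact (mul_eq_zero.1 h).resolve_right hg0
    · rintro ⟨i, j⟩ hij hne
      rw [Finset.HasAntidiagonal.mem_antidiagonal] at hij
      simp only at hij ⊢
      by_cases hj : j ∈ H
      · have hi : i ∉ H := fun hi => hm (hij ▸ H.add_mem hi hj)
        have hj0 : j ≠ 0 := by
          rintro rfl
          exact hne (by simp at hij; simp [hij])
        rw [ih i (by omega) hi, zero_mul]
      · rw [hg j hj, mul_zero]
    · intro h'
      exact absurd (Finset.HasAntidiagonal.mem_antidiagonal.2 (by simp)) h'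


theorem IsConductorExponent.mem_of_X_pow_dvd {c : ℕ} (hc : IsConductorExponent H c) {v : k⟦X⟧}
    (hv : X ^ c ∣ v) : v ∈ semigroupRing k H := by
  intro m hm
  rw [X_pow_dvd_iff] at hv
  exact hv m (not_le.1 fun h => hm (hc.mem_of_le m h))

/-- A shift moves any coefficient below `c` to the position `c - 1`, which is a gap. -/
theorem IsConductorExponent.X_pow_dvd_of_mul {c : ℕ} (hc : IsConductorExponent H c) {v : k⟦X⟧}
    (hv : ∀ j, v * X ^ j ∈ semigroupRing k H) : X ^ c ∣ v := by
  obtain ⟨e, rfl, he⟩ := hc.pred_notMem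
  rw [X_pow_dvd_iff]
  intro m hm
  have := hv (e - m) e he
  rwa [coeff_mul_X_pow', if_pos (by omega), show e - (e - m) = m by omega] at this

theorem IsColonReflexive.containsTail {c : ℕ} (hc : IsConductorExponent H c)
    {I : Ideal (semigroupRing k H)} (hI : IsColonReflexive I) : ContainsTail c I :=
  fun v hv => hI v fun _ _ => hc.mem_of_X_pow_dvd (hv.mul_left _)

/-! ### Rank one reflexive modules as ideals -/

/-- Every nonzero set of power series in a suitable family has a member of minimal order. -/
theorem PowerSeries.exists_forall_dvd {ι : Type*} (F : ι → k⟦X⟧) (h : ∃ i, F i ≠ 0) :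
    ∃ i, F i ≠ 0 ∧ ∀ j, F i ∣ F j := by
  classical
  have hex : ∃ n, ∃ i, coeff n (F i) ≠ 0 := by
    obtain ⟨i, hi⟩ := h
    by_contra! hcon
    exact hi (PowerSeries.ext fun n => by simpa using hcon n i)
  obtain ⟨i, hi⟩ := Nat.find_spec hex
  have hmin : ∀ j, X ^ (Nat.find hex) ∣ F j := fun j => by
    rw [X_pow_dvd_iff]
    intro m hm
    by_contra hne
    exact Nat.find_min hex hm ⟨j, hne⟩
  exact ⟨i, fun h0 => hi (by simp [h0]), fun j => PowerSeries.dvd_of_X_pow_dvd (hmin j) (hmin i) hi⟩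

/-- A functional `φ` of least order at `m₀` divides all others in `k⟦X⟧`: `ψ = q ψ * φ`. The `q ψ`
are then multipliers of the ideal `φ(M)`, and any `g` in its double colon gives a functional `ψ ↦ q
ψ * g` on the dual, which reflexivity realises as an element of `M`. -/
theorem exists_ideal_of_isRankOneReflexive (M : Type u) [AddCommGroup M]
    [Module (semigroupRing k H) M] (hM : IsRankOneReflexive (semigroupRing k H) M) :
    ∃ I : Ideal (semigroupRing k H), Nonempty (M ≃ₗ[semigroupRing k H] I) ∧
      IsColonReflexive I := by
  obtain ⟨hrefl, hrank⟩ := hM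
  have hbij := Module.bijective_dual_eval (semigroupRing k H) M
  have hsep : ∀ m : M, (∀ ψ : Module.Dual (semigroupRing k H) M, ψ m = 0) → m = 0 := by
    intro m hm
    apply hbij.1
    rw [map_zero]
    ext ψ
    simp [hm ψ]
  have hne : ∃ m : M, m ≠ 0 := by
    by_contra! h
    have : Subsingleton M := ⟨fun x y => (h x).trans (h y).symm⟩
    rw [rank_subsingleton' ] at hrank
    exact zero_ne_one hrank
  obtain ⟨m₀, hm₀⟩ := hne
  have hdep : ∀ m : M, ∃ r s : semigroupRing k H, s ≠ 0 ∧ s • m = r • m₀ := by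
    intro m
    have hnot : ¬ LinearIndependent (semigroupRing k H) ![m₀, m] := by
      intro hli
      have := hli.cardinal_lift_le_rank
      rw [hrank] at this
      simp at this
    rw [LinearIndependent.pair_iff] at hnot
    push Not at hnot
    obtain ⟨r, s, hrs, h⟩ := hnot
    refine ⟨-r, s, ?_, ?_⟩
    · rintro rfl
      have hr : r ≠ 0 := fun h0 => h h0 rfl
      rw [zero_smul, add_zero] at hrs
      refine hm₀ (hsep _ fun ψ => ?_)
      have := congrArg ψ hrs
      rw [map_smul, map_zero, smul_eq_mul] at this
      exact (mul_eq_zero.1 this).resolve_left hr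
    · rw [neg_smul, eq_neg_iff_add_eq_zero, add_comm]
      exact hrs
  have hex : ∃ ψ : Module.Dual (semigroupRing k H) M, ((ψ m₀ : semigroupRing k H) : k⟦X⟧) ≠ 0 := by
    by_contra! h
    exact hm₀ (hsep _ fun ψ => Subtype.ext (h ψ))
  obtain ⟨φ, hφ0, hφ⟩ := PowerSeries.exists_forall_dvd _ hex
  choose q hq using hφ
  -- The quotient is defined at `m₀` only; rank one makes `s • m = r • m₀`, which carries it over to
  -- every `m`.
  have hqm : ∀ ψ m, q ψ * ((φ m : semigroupRing k H) : k⟦X⟧) = (ψ m : semigroupRing k H) := by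
    intro ψ m
    obtain ⟨r, s, hs, hrs⟩ := hdep m
    have hs' : (s : k⟦X⟧) ≠ 0 := fun h => hs (Subtype.ext h)
    have h1 : ∀ χ : Module.Dual (semigroupRing k H) M,
        (s : k⟦X⟧) * (χ m : semigroupRing k H) = r * (χ m₀ : semigroupRing k H) := fun χ => by
      have := congrArg (fun z => ((χ z : semigroupRing k H) : k⟦X⟧)) hrs
      simpa using this
    apply mul_left_cancel₀ hs'
    rw [h1 ψ, mul_left_comm, h1 φ, hq ψ]
    ring
  have hinj : Function.Injective φ := by
    rw [injective_iff_map_eq_zero]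
    intro m hm
    refine hsep m fun ψ => Subtype.ext ?_
    rw [← hqm ψ m, hm]
    simp
  refine ⟨LinearMap.range φ, ⟨LinearEquiv.ofInjective φ hinj⟩, fun g hg => ?_⟩
  have hqg : ∀ ψ, q ψ * g ∈ semigroupRing k H := by
    intro ψ
    apply hg
    intro y hy
    obtain ⟨hyR, m, hm⟩ := Ideal.mem_toSeries.1 hy
    have : y = (φ m : semigroupRing k H) := by rw [hm]
    rw [this, hqm]
    exact (ψ m).2
  have hqadd : ∀ ψ χ, q (ψ + χ) = q ψ + q χ := fun ψ χ => by
    apply mul_left_cancel₀ hφ0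
    rw [mul_add, ← hq, ← hq, ← hq]
    simp
  have hqsmul : ∀ (r : semigroupRing k H) ψ, q (r • ψ) = r * q ψ := fun r ψ => by
    apply mul_left_cancel₀ hφ0
    rw [mul_left_comm, ← hq, ← hq]
    simp
  let Φ : Module.Dual (semigroupRing k H) (Module.Dual (semigroupRing k H) M) :=
    { toFun := fun ψ => ⟨q ψ * g, hqg ψ⟩
      map_add' := fun ψ χ => Subtype.ext (by simp [hqadd, add_mul])
      map_smul' := fun r ψ => Subtype.ext (by simp [hqsmul, mul_assoc]) }
  obtain ⟨m, hm⟩ := hbij.2 Φ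
  have hq1 : q φ = 1 := by
    apply mul_left_cancel₀ hφ0
    rw [← hq, mul_one]
  have hmφ : ((φ m : semigroupRing k H) : k⟦X⟧) = g := by
    have := congrArg (fun z => ((z φ : semigroupRing k H) : k⟦X⟧)) hm
    simpa [Φ, hq1] using this
  rw [← hmφ, Ideal.coe_mem_toSeries]
  exact ⟨m, rfl⟩

/-! ### Trace ideals and reflexive ideals of a commutative ring -/

section General

variable {R : Type u} [CommRing R]

theorem le_traceOfModule_self (I : Ideal R) : I ≤ traceOfModule R I := by
  refine le_trans ?_ (le_iSup _ I.subtype)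
  rw [Submodule.range_subtype]

/-- Composing `f : M → R`, whose values lie in the trace, with `φ` gives another functional on `M`.
-/
theorem range_le_traceOfModule {M : Type u} [AddCommGroup M] [Module R M]
    (φ : traceOfModule R M →ₗ[R] R) : LinearMap.range φ ≤ traceOfModule R M := by
  have key : ∀ x (hx : x ∈ traceOfModule R M), φ ⟨x, hx⟩ ∈ traceOfModule R M := by
    intro x hx
    unfold traceOfModule at hx
    induction hx using Submodule.iSup_induction' with
    | mem f x hx =>
      obtain ⟨m, rfl⟩ := hx
      have hle : ∀ m, f m ∈ traceOfModule R M := fun m =>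
        (le_iSup (fun f : M →ₗ[R] R => LinearMap.range f) f) ⟨m, rfl⟩
      exact (le_iSup (fun f : M →ₗ[R] R => LinearMap.range f) (φ ∘ₗ f.codRestrict _ hle)) ⟨m, rfl⟩
    | zero => exact (map_zero φ).symm ▸ Submodule.zero_mem _
    | add x y hx hy ihx ihy =>
      have := Submodule.add_mem _ ihx ihy
      rwa [← map_add] at this
  rintro _ ⟨⟨x, hx⟩, rfl⟩
  exact key x hx

theorem traceOfModule_congr {M N : Type u} [AddCommGroup M] [Module R M] [AddCommGroup N]
    [Module R N] (e : M ≃ₗ[R] N) : traceOfModule R M = traceOfModule R N := by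
  apply le_antisymm
  · refine iSup_le fun f => le_trans ?_ (le_iSup _ (f ∘ₗ e.symm.toLinearMap))
    rintro _ ⟨m, rfl⟩
    exact ⟨e m, by simp⟩
  · refine iSup_le fun f => le_trans ?_ (le_iSup _ (f ∘ₗ e.toLinearMap))
    rintro _ ⟨m, rfl⟩
    exact ⟨e.symm m, by simp⟩

theorem range_le_of_mem_regularTraceIdeals {I : Ideal R} (hI : I ∈ regularTraceIdeals R)
    (φ : I →ₗ[R] R) : LinearMap.range φ ≤ I := by
  obtain ⟨-, M, _, _, rfl⟩ := hI
  exact range_le_traceOfModule φ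

theorem traceOfModule_eq_self {I : Ideal R} (hI : ∀ φ : I →ₗ[R] R, LinearMap.range φ ≤ I) :
    traceOfModule R I = I :=
  le_antisymm (iSup_le hI) (le_traceOfModule_self I)

/-- A functional `Φ` on the dual is evaluation at `Φ(incl)`, with `incl` the inclusion of `I` in
`R`. This element lies in `R : (R : I) = I`, because multiplication by `p ∈ R : I` is a functional
`ψ` with `Φ ψ = p Φ(incl)`. -/
theorem IsReflexiveIdeal.isRankOneReflexive [IsDomain R] {I : Ideal R} (hI : IsReflexiveIdeal I)
    (hI0 : I ≠ ⊥) : IsRankOneReflexive R I := by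
  obtain ⟨x, hx, hx0⟩ := Submodule.exists_mem_ne_zero_of_ne_bot hI0
  have hψ : ∀ (ψ : Module.Dual R I) (y : I), x * ψ y = y * ψ ⟨x, hx⟩ := by
    intro ψ y
    rw [← smul_eq_mul, ← smul_eq_mul, ← map_smul, ← map_smul]
    congr 1
    exact Subtype.ext (mul_comm _ _)
  refine ⟨⟨⟨?_, ?_⟩⟩, ?_⟩
  · intro y z hyz
    have := congrArg (fun Φ => Φ I.subtype) hyz
    exact Subtype.ext this
  · intro Φ
    have hΦ : ∀ ψ : Module.Dual R I, x * Φ ψ = ψ ⟨x, hx⟩ * Φ I.subtype := by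
      intro ψ
      rw [← smul_eq_mul, ← smul_eq_mul, ← map_smul, ← map_smul]
      congr 1
      ext y
      simp [hψ ψ y, mul_comm]
    have hmem : Φ I.subtype ∈ I := by
      have hK : algebraMap R (FractionRing R) (Φ I.subtype) ∈
          IsLocalization.coeSubmodule (FractionRing R) I := by
        rw [← hI, Submodule.mem_div_iff_forall_mul_mem]
        intro p hp
        rw [Submodule.mem_div_iff_forall_mul_mem] at hp
        have hp' : ∀ y : I, ∃ r : R, algebraMap R (FractionRing R) r =
            p * algebraMap R (FractionRing R) y := fun y =>
          Submodule.mem_one.1 (hp _ ((IsLocalization.mem_coeSubmodule _ _).2 ⟨y, y.2, rfl⟩))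
        choose r hr using hp'
        have hinj := IsFractionRing.injective R (FractionRing R)
        let ψ : Module.Dual R I :=
          { toFun := r
            map_add' := fun y z => hinj (by simp [hr, mul_add])
            map_smul' := fun s y => hinj (by simp [hr, mul_left_comm]) }
        rw [Submodule.mem_one]
        refine ⟨Φ ψ, ?_⟩
        have h1 := congrArg (algebraMap R (FractionRing R)) (hΦ ψ)
        have h2 : algebraMap R (FractionRing R) (ψ ⟨x, hx⟩) = p * algebraMap R (FractionRing R) x :=
          hr _
        rw [map_mul, map_mul, h2] at h1
        apply mul_left_cancel₀ ((map_ne_zero_iff _ hinj).2 hx0)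
        rw [h1]
        ring
      obtain ⟨y, hy, hyeq⟩ := (IsLocalization.mem_coeSubmodule _ _).1 hK
      rwa [← IsFractionRing.injective R (FractionRing R) hyeq]
    refine ⟨⟨_, hmem⟩, ?_⟩
    ext ψ
    apply mul_left_cancel₀ hx0
    rw [hΦ, Module.Dual.eval_apply, hψ, mul_comm]
  · apply le_antisymm
    · exact (LinearMap.rank_le_of_injective I.subtype Subtype.val_injective).trans (Module.rank_self R).le
    · rw [Cardinal.one_le_iff_pos, rank_pos_iff_exists_ne_zero]
      exact ⟨⟨x, hx⟩, fun h => hx0 (congrArg Subtype.val h)⟩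

theorem ne_bot_of_mem_regularTraceIdeals [Nontrivial R] {I : Ideal R}
    (hI : I ∈ regularTraceIdeals R) : I ≠ ⊥ := by
  rintro rfl
  obtain ⟨⟨x, hx, hx'⟩, -⟩ := hI
  rw [Ideal.mem_bot] at hx
  exact nonZeroDivisors.ne_zero hx' hx

/-- A trace ideal is its own trace and the trace depends only on the isomorphism class, so distinct
trace ideals are not isomorphic. -/
theorem finite_reflexiveTraceIdeals [IsDomain R] (h : (rankOneReflexiveClasses R).Finite) :
    (reflexiveTraceIdeals R).Finite := by
  refine Set.Finite.of_finite_image (f := fun I : Ideal R =>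
    (Quotient.mk (CategoryTheory.isIsomorphicSetoid (ModuleCat.{u} R)) (ModuleCat.of R I)))
    (h.subset ?_) ?_
  · rintro _ ⟨I, hI, rfl⟩
    exact ⟨ModuleCat.of R I, hI.2.isRankOneReflexive (ne_bot_of_mem_regularTraceIdeals hI.1), rfl⟩
  · intro I hI J hJ hIJ
    obtain ⟨e⟩ := Quotient.exact hIJ
    rw [← traceOfModule_eq_self (range_le_of_mem_regularTraceIdeals hI.1),
      ← traceOfModule_eq_self (range_le_of_mem_regularTraceIdeals hJ.1)]
    exact traceOfModule_congr e.toLinearEquiv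

theorem finite_rankOneReflexiveClasses_of_finite {s : Set (Ideal R)} (hs : s.Finite)
    (h : ∀ (M : Type u) [AddCommGroup M] [Module R M], IsRankOneReflexive R M →
      ∃ I ∈ s, Nonempty (M ≃ₗ[R] I)) : (rankOneReflexiveClasses R).Finite := by
  refine (hs.image fun I : Ideal R =>
    (Quotient.mk (CategoryTheory.isIsomorphicSetoid (ModuleCat.{u} R))
      (ModuleCat.of R I))).subset ?_
  rintro _ ⟨M, hM, rfl⟩
  obtain ⟨I, hI, ⟨e⟩⟩ := h M hM
  exact ⟨I, hI, Quotient.sound ⟨e.symm.toModuleIso⟩⟩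

end General

/-! ### Conductor, trace ideals and reflexive ideals of `k⟦H⟧` -/

variable {c : ℕ}

theorem IsConductorExponent.X_pow_mem (hc : IsConductorExponent H c) (v : k⟦X⟧) :
    X ^ c * v ∈ semigroupRing k H :=
  hc.mem_of_X_pow_dvd (dvd_mul_right _ _)

theorem IsConductorExponent.X_pow_dvd_of_mem_conductorIdeal (hc : IsConductorExponent H c)
    {r : semigroupRing k H} (hr : r ∈ conductorIdeal (semigroupRing k H)) :
    (X : k⟦X⟧) ^ c ∣ (r : k⟦X⟧) := by
  set K := FractionRing (semigroupRing k H)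
  have hinj := IsFractionRing.injective (semigroupRing k H) K
  let tc : semigroupRing k H := ⟨X ^ c, hc.mem_of_X_pow_dvd dvd_rfl⟩
  let tc1 : semigroupRing k H := ⟨X ^ (c + 1), hc.mem_of_X_pow_dvd (pow_dvd_pow _ (by omega))⟩
  have htc : algebraMap _ K tc ≠ 0 := by
    rw [map_ne_zero_iff _ hinj]
    exact fun h => (pow_ne_zero c (X_ne_zero (R := k))) (congrArg Subtype.val h)
  have hcpos : 0 < c := by
    obtain ⟨m, hm, -⟩ := hc.pred_notMem
    omega
  have hpow : tc1 ^ c = tc * tc ^ c := Subtype.ext (by simp [tc, tc1]; ring)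
  -- This quotient is `t` itself, realised in `Q(R)` as `t ^ (c + 1) / t ^ c`; it is integral
  -- because `t ^ c ∈ R`.
  have hint : IsIntegral (semigroupRing k H) (algebraMap _ K tc1 / algebraMap _ K tc) := by
    refine IsIntegral.of_pow hcpos ?_
    rw [div_pow, ← map_pow, hpow, map_mul, map_pow, mul_div_assoc,
      div_self (pow_ne_zero _ htc), mul_one]
    exact isIntegral_algebraMap
  apply hc.X_pow_dvd_of_mul
  intro j
  obtain ⟨s, hs⟩ := Submodule.mem_one.1 (Submodule.mem_div_iff_forall_mul_mem.1 hr _ (hint.pow j))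
  rw [div_pow, mul_div_assoc', eq_div_iff (pow_ne_zero _ htc), Algebra.linearMap_apply,
    ← map_pow, ← map_pow, ← map_mul, ← map_mul] at hs
  have hs' : (s : k⟦X⟧) * ((X : k⟦X⟧) ^ c) ^ j = (r : k⟦X⟧) * (X ^ (c + 1)) ^ j := by
    simpa [tc, tc1] using congrArg Subtype.val (hinj hs)
  have : (s : k⟦X⟧) = (r : k⟦X⟧) * (X : k⟦X⟧) ^ j := by
    apply mul_right_cancel₀ (pow_ne_zero j (pow_ne_zero c (X_ne_zero (R := k))))
    rw [hs']
    ring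
  rw [← this]
  exact s.2

theorem IsConductorExponent.mem_conductorIdeal (hc : IsConductorExponent H c)
    {r : semigroupRing k H} (hr : (X : k⟦X⟧) ^ c ∣ (r : k⟦X⟧)) :
    r ∈ conductorIdeal (semigroupRing k H) := by
  refine Submodule.mem_div_iff_forall_mul_mem.2 fun q hq => ?_
  have hinj := IsFractionRing.injective (semigroupRing k H) (FractionRing (semigroupRing k H))
  let φ : semigroupRing k H →+* k⟦X⟧ := (semigroupRing k H).subtype
  have hφ : Function.Injective φ := Subtype.val_injective
  let Φ : FractionRing (semigroupRing k H) →+* FractionRing k⟦X⟧ := IsFractionRing.map hφ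
  have hΦ : ∀ s, Φ (algebraMap _ _ s) = algebraMap _ _ (φ s) := fun s => IsLocalization.map_eq _ s
  -- Since `k⟦X⟧` is integrally closed, an integral element of `Q(R)` becomes a power series in the
  -- larger fraction field.
  have hq' : IsIntegral k⟦X⟧ (Φ q) :=
    IsIntegral.map_of_comp_eq φ Φ (RingHom.ext fun s => (hΦ s).symm) hq
  obtain ⟨v, hv⟩ := IsIntegrallyClosed.isIntegral_iff.1 hq'
  obtain ⟨w, hw⟩ := hr
  rw [Submodule.mem_one]
  refine ⟨⟨r * v, hc.mem_of_X_pow_dvd ⟨w * v, by rw [hw, mul_assoc]⟩⟩, Φ.injective ?_⟩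
  rw [hΦ, map_mul, Algebra.linearMap_apply, hΦ, ← hv, ← map_mul]
  rfl

/-- The multiplier is `φ(X ^ c) / X ^ c`. It is a power series because `φ(X ^ c) X ^ j = φ(X ^ (c +
j))` lies in `R` for all `j`. -/
theorem ContainsTail.exists_forall_eq_mul (hc : IsConductorExponent H c)
    {I : Ideal (semigroupRing k H)} (hI : ContainsTail c I) (φ : I →ₗ[semigroupRing k H]
      semigroupRing k H) : ∃ f : k⟦X⟧, ∀ y : I, (φ y : k⟦X⟧) = f * (y : semigroupRing k H) := by
  have hmem : ∀ j, (⟨X ^ c * X ^ j, hc.X_pow_mem _⟩ : semigroupRing k H) ∈ I := fun j =>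
    Ideal.coe_mem_toSeries.1 (hI _ (dvd_mul_right _ _))
  have hmem0 : (⟨X ^ c, hc.mem_of_X_pow_dvd dvd_rfl⟩ : semigroupRing k H) ∈ I :=
    Ideal.coe_mem_toSeries.1 (hI _ dvd_rfl)
  have hcomm : ∀ y z : I, ((y : semigroupRing k H) : k⟦X⟧) * φ z = (z : semigroupRing k H) * φ y := by
    intro y z
    have : (y : semigroupRing k H) • φ z = (z : semigroupRing k H) • φ y := by
      rw [← map_smul, ← map_smul]
      congr 1
      exact Subtype.ext (mul_comm _ _)
    exact congrArg Subtype.val this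
  have hX : ∀ n, (X : k⟦X⟧) ^ n ≠ 0 := fun n => pow_ne_zero n X_ne_zero
  have hdvd : X ^ c ∣ (φ ⟨_, hmem0⟩ : k⟦X⟧) := by
    apply hc.X_pow_dvd_of_mul
    intro j
    have h := hcomm ⟨_, hmem0⟩ ⟨_, hmem j⟩
    simp only [mul_assoc] at h
    rw [mul_comm, ← mul_left_cancel₀ (hX c) h]
    exact Subtype.mem _
  obtain ⟨f, hf⟩ := hdvd
  refine ⟨f, fun y => mul_left_cancel₀ (hX c) ?_⟩
  have h := hcomm ⟨_, hmem0⟩ y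
  simp only at h
  rw [h, hf]
  ring

theorem ContainsTail.mem_regularTraceIdeals (hc : IsConductorExponent H c)
    {I : Ideal (semigroupRing k H)} (hI : ContainsTail c I) (hst : IsColonStable I) :
    I ∈ regularTraceIdeals (semigroupRing k H) := by
  refine ⟨⟨⟨X ^ c, hc.mem_of_X_pow_dvd dvd_rfl⟩, Ideal.coe_mem_toSeries.1 (hI _ dvd_rfl), ?_⟩,
    I, _, _, (traceOfModule_eq_self fun φ => ?_).symm⟩
  · exact mem_nonZeroDivisors_of_ne_zero
      fun h => (pow_ne_zero c (X_ne_zero (R := k))) (congrArg Subtype.val h)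
  · obtain ⟨f, hf⟩ := hI.exists_forall_eq_mul hc φ
    rintro _ ⟨y, rfl⟩
    rw [← Ideal.coe_mem_toSeries, hf]
    refine hst f (fun z hz => ?_) _ (Ideal.coe_mem_toSeries.2 y.2)
    obtain ⟨hzR, hzI⟩ := Ideal.mem_toSeries.1 hz
    have := hf ⟨_, hzI⟩
    simp only at this
    rw [← this]
    exact Subtype.mem _

/-- Multiplication by `f` as a linear map on an ideal `I` with `f * I ⊆ R`. -/
noncomputable def Ideal.mulSeries (I : Ideal (semigroupRing k H)) (f : k⟦X⟧)
    (hf : ∀ y ∈ I.toSeries, f * y ∈ semigroupRing k H) :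
    I →ₗ[semigroupRing k H] semigroupRing k H where
  toFun y := ⟨f * (y : semigroupRing k H), hf _ (Ideal.coe_mem_toSeries.2 y.2)⟩
  map_add' y z := Subtype.ext (by simp [mul_add])
  map_smul' r y := Subtype.ext (by simp [mul_left_comm])

theorem isColonStable_of_mem_regularTraceIdeals {I : Ideal (semigroupRing k H)}
    (hI : I ∈ regularTraceIdeals (semigroupRing k H)) : IsColonStable I := by
  intro f hf y hy
  obtain ⟨hyR, hyI⟩ := Ideal.mem_toSeries.1 hy
  have := range_le_of_mem_regularTraceIdeals hI (I.mulSeries f hf) ⟨⟨_, hyI⟩, rfl⟩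
  rw [← Ideal.coe_mem_toSeries] at this
  exact this

/-- For `y ∈ I` of least order and `v` in the tail, `z ↦ (z / y) v` maps `I` into `R` and `y` to
`v`; a trace ideal contains the images of its functionals. -/
theorem containsTail_of_mem_regularTraceIdeals (hc : IsConductorExponent H c)
    {I : Ideal (semigroupRing k H)} (hI : I ∈ regularTraceIdeals (semigroupRing k H)) :
    ContainsTail c I := by
  obtain ⟨x, hx, hx0⟩ := Submodule.exists_mem_ne_zero_of_ne_bot (ne_bot_of_mem_regularTraceIdeals hI)
  obtain ⟨y, hy0, hy⟩ := PowerSeries.exists_forall_dvd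
    (fun y : I => ((y : semigroupRing k H) : k⟦X⟧)) ⟨⟨x, hx⟩, fun h => hx0 (Subtype.ext h)⟩
  choose q hq using hy
  intro v hv
  have hmem : ∀ z, q z * v ∈ semigroupRing k H := fun z => hc.mem_of_X_pow_dvd (hv.mul_left _)
  let φ : I →ₗ[semigroupRing k H] semigroupRing k H :=
    { toFun := fun z => ⟨q z * v, hmem z⟩
      map_add' := fun z w => Subtype.ext (by
        have : q (z + w) = q z + q w := mul_left_cancel₀ hy0 (by
          rw [mul_add, ← hq, ← hq, ← hq]
          simp)
        simp [this, add_mul])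
      map_smul' := fun r z => Subtype.ext (by
        have : q (r • z) = r * q z := mul_left_cancel₀ hy0 (by
          rw [mul_left_comm, ← hq, ← hq]
          simp)
        simp [this, mul_assoc]) }
  have hqy : q y = 1 := mul_left_cancel₀ hy0 (by rw [← hq, mul_one])
  have := range_le_of_mem_regularTraceIdeals hI φ ⟨y, rfl⟩
  rw [← Ideal.coe_mem_toSeries] at this
  simpa [φ, hqy] using this

theorem IsColonReflexive.isReflexiveIdeal (hc : IsConductorExponent H c)
    {I : Ideal (semigroupRing k H)} (hI : IsColonReflexive I) : IsReflexiveIdeal I := by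
  set K := FractionRing (semigroupRing k H)
  have hinj := IsFractionRing.injective (semigroupRing k H) K
  apply le_antisymm
  · intro q hq
    rw [Submodule.mem_div_iff_forall_mul_mem] at hq
    -- As `1 ∈ R : I`, the double colon lies in `R`.
    have h1 : q * 1 ∈ (1 : Submodule (semigroupRing k H) K) := hq 1 (by
      rw [Submodule.mem_div_iff_forall_mul_mem]
      rintro _ hy
      obtain ⟨y, -, rfl⟩ := (IsLocalization.mem_coeSubmodule _ _).1 hy
      rw [one_mul]
      exact Submodule.mem_one.2 ⟨y, rfl⟩)
    rw [mul_one] at h1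
    obtain ⟨g, rfl⟩ := Submodule.mem_one.1 h1
    refine (IsLocalization.mem_coeSubmodule _ _).2 ⟨g, Ideal.coe_mem_toSeries.1 (hI _ ?_), rfl⟩
    intro f hf
    let tc : semigroupRing k H := ⟨X ^ c, hc.mem_of_X_pow_dvd dvd_rfl⟩
    let tcf : semigroupRing k H := ⟨X ^ c * f, hc.X_pow_mem f⟩
    have htc : algebraMap _ K tc ≠ 0 := by
      rw [map_ne_zero_iff _ hinj]
      exact fun h => (pow_ne_zero c (X_ne_zero (R := k))) (congrArg Subtype.val h)
    obtain ⟨s, hs⟩ := Submodule.mem_one.1 (hq (algebraMap _ K tcf / algebraMap _ K tc) (by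
      rw [Submodule.mem_div_iff_forall_mul_mem]
      rintro _ hy
      obtain ⟨y, hyI, rfl⟩ := (IsLocalization.mem_coeSubmodule _ _).1 hy
      refine Submodule.mem_one.2 ⟨⟨f * y, hf _ (Ideal.coe_mem_toSeries.2 hyI)⟩, ?_⟩
      rw [div_mul_eq_mul_div, eq_div_iff htc, ← map_mul, ← map_mul]
      congr 1
      exact Subtype.ext (by simp [tc, tcf]; ring)))
    rw [mul_div_assoc', eq_div_iff htc, ← map_mul, ← map_mul] at hs
    have hs' : (s : k⟦X⟧) * X ^ c = (g : k⟦X⟧) * (X ^ c * f) := by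
      simpa [tc, tcf] using congrArg Subtype.val (hinj hs)
    have : f * g = (s : k⟦X⟧) := by
      apply mul_right_cancel₀ (pow_ne_zero c (X_ne_zero (R := k)))
      rw [hs']
      ring
    rw [this]
    exact s.2
  · intro y hy
    rw [Submodule.mem_div_iff_forall_mul_mem]
    intro p hp
    rw [mul_comm]
    exact Submodule.mem_div_iff_forall_mul_mem.1 hp y hy

/-! ### Monomial ideals of `k⟦H⟧` -/

theorem PowerSeries.X_pow_dvd_sub_sum (f : k⟦X⟧) (n : ℕ) :
    X ^ n ∣ f - ∑ m ∈ Finset.range n, C (coeff m f) * X ^ m := by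
  rw [X_pow_dvd_iff]
  intro m hm
  simp [coeff_X_pow, hm]

theorem mem_of_X_pow_mem_semigroupRing {m : ℕ} (h : (X ^ m : k⟦X⟧) ∈ semigroupRing k H) :
    m ∈ H := by
  by_contra hm
  have := h m hm
  rw [coeff_X_pow_self] at this
  exact one_ne_zero this

theorem isMonomialIdeal_of_forall (hc : IsConductorExponent H c) {I : Ideal (semigroupRing k H)}
    (hI : ContainsTail c I)
    (h : ∀ f ∈ I.toSeries, ∀ m < c, coeff m f ≠ 0 → X ^ m ∈ I.toSeries) :
    IsMonomialIdeal I := by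
  refine ⟨{m | (X ^ m : k⟦X⟧) ∈ I.toSeries},
    fun m hm => mem_of_X_pow_mem_semigroupRing (Ideal.mem_semigroupRing_of_mem_toSeries hm),
    le_antisymm ?_ ?_⟩
  · intro r hr
    set N := Ideal.span {f : semigroupRing k H | ∃ h ∈ {m | (X ^ m : k⟦X⟧) ∈ I.toSeries},
      (f : k⟦X⟧) = X ^ h}
    have hN : ∀ m, (X ^ m : k⟦X⟧) ∈ I.toSeries → (X ^ m : k⟦X⟧) ∈ N.toSeries := fun m hm =>
      Ideal.mem_toSeries.2 ⟨Ideal.mem_semigroupRing_of_mem_toSeries hm,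
        Ideal.subset_span ⟨m, hm, rfl⟩⟩
    -- Truncation at `2c` rather than `c`: the remainder is then the generator `X ^ c` times an
    -- element of `R`, hence in the monomial ideal.
    rw [← Ideal.coe_mem_toSeries, ← sub_add_cancel (r : k⟦X⟧)
      (∑ m ∈ Finset.range (c + c), C (coeff m (r : k⟦X⟧)) * X ^ m)]
    refine add_mem ?_ (sum_mem fun m _ => ?_)
    · obtain ⟨w, hw⟩ := PowerSeries.X_pow_dvd_sub_sum (r : k⟦X⟧) (c + c)
      rw [hw, pow_add, mul_assoc, mul_comm]
      exact Ideal.mul_mem_toSeries (hc.X_pow_mem w) (hN _ (hI _ dvd_rfl))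
    · by_cases h0 : coeff m (r : k⟦X⟧) = 0
      · rw [h0, map_zero, zero_mul]
        exact zero_mem _
      · refine Ideal.mul_mem_toSeries (C_mem_semigroupRing _) (hN _ ?_)
        by_cases hm : m < c
        · exact h _ (Ideal.coe_mem_toSeries.2 hr) m hm h0
        · exact hI _ (pow_dvd_pow _ (not_lt.1 hm))
  · rw [Ideal.span_le]
    rintro f ⟨m, hm, hf⟩
    rw [SetLike.mem_coe, ← Ideal.coe_mem_toSeries, hf]
    exact hm

theorem ContainsTail.conductorIdeal_le (hc : IsConductorExponent H c)
    {I : Ideal (semigroupRing k H)} (hI : ContainsTail c I) :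
    conductorIdeal (semigroupRing k H) ≤ I := fun _ hr =>
  Ideal.coe_mem_toSeries.1 (hI _ (hc.X_pow_dvd_of_mem_conductorIdeal hr))

theorem finite_monomialIdeals (hc : IsConductorExponent H c) :
    {I : Ideal (semigroupRing k H) |
      IsMonomialIdeal I ∧ conductorIdeal (semigroupRing k H) ≤ I}.Finite := by
  classical
  refine Set.Finite.of_finite_image (f := fun I : Ideal (semigroupRing k H) =>
    (Finset.range c).filter fun m => (X ^ m : k⟦X⟧) ∈ I.toSeries)
    ((Finset.range c).powerset.finite_toSet.subset ?_) ?_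
  · rintro _ ⟨I, -, rfl⟩
    exact Finset.mem_coe.2 (Finset.mem_powerset.2 (Finset.filter_subset _ _))
  · have key : ∀ I J : Ideal (semigroupRing k H), IsMonomialIdeal I →
        conductorIdeal (semigroupRing k H) ≤ J →
        ((Finset.range c).filter fun m => (X ^ m : k⟦X⟧) ∈ I.toSeries) =
        ((Finset.range c).filter fun m => (X ^ m : k⟦X⟧) ∈ J.toSeries) → I ≤ J := by
      rintro I J ⟨S, -, rfl⟩ hJ hIJ
      rw [Ideal.span_le]
      rintro f ⟨m, hm, hf⟩
      by_cases hmc : m < c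
      · have : m ∈ (Finset.range c).filter fun m => (X ^ m : k⟦X⟧) ∈ J.toSeries := by
          rw [← hIJ, Finset.mem_filter, Finset.mem_range, ← hf, Ideal.coe_mem_toSeries]
          exact ⟨hmc, Ideal.subset_span ⟨m, hm, hf⟩⟩
        rw [Finset.mem_filter, ← hf, Ideal.coe_mem_toSeries] at this
        exact this.2
      · exact hJ (hc.mem_conductorIdeal (hf ▸ pow_dvd_pow _ (not_lt.1 hmc)))
    intro I hI J hJ hIJ
    exact le_antisymm (key I J hI.1 hJ.2 hIJ) (key J I hJ.1 hI.2 hIJ.symm)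

/-- Modulo the tail, `I` is `w` times the span of the `X ^ s`, `s ∈ S`. Multiplication by the
inverse of `w`, which need not lie in `R`, carries `I` isomorphically onto a monomial ideal. -/
theorem exists_monomialIdeal_equiv (hc : IsConductorExponent H c) {I : Ideal (semigroupRing k H)}
    (hI : ContainsTail c I) (w : k⟦X⟧) (hw : coeff 0 w ≠ 0) (S : Set ℕ)
    (h₁ : ∀ f ∈ I.toSeries, ∃ p : k⟦X⟧, (∀ m < c, m ∉ S → coeff m p = 0) ∧ X ^ c ∣ f - w * p)
    (h₂ : ∀ s ∈ S, w * X ^ s ∈ I.toSeries) (hS : S ⊆ H) :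
    ∃ J : Ideal (semigroupRing k H), IsMonomialIdeal J ∧
      conductorIdeal (semigroupRing k H) ≤ J ∧ Nonempty (I ≃ₗ[semigroupRing k H] J) := by
  have hwu : IsUnit w := by
    rw [PowerSeries.isUnit_iff_constantCoeff, ← coeff_zero_eq_constantCoeff_apply]
    exact isUnit_iff_ne_zero.2 hw
  obtain ⟨u, hu⟩ := isUnit_iff_exists_inv.1 hwu
  have hsupp : ∀ f ∈ I.toSeries, ∀ m < c, m ∉ S → coeff m (u * f) = 0 := by
    intro f hf m hm hmS
    obtain ⟨p, hp, hdvd⟩ := h₁ f hf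
    have : u * f = p + u * (f - w * p) := by linear_combination p * hu
    rw [this, map_add, hp m hm hmS, X_pow_dvd_iff.1 (hdvd.mul_left u) m hm, add_zero]
  have hmem : ∀ f ∈ I.toSeries, u * f ∈ semigroupRing k H := by
    intro f hf m hm
    exact hsupp f hf m (not_le.1 fun h => hm (hc.mem_of_le m h)) fun h => hm (hS h)
  have hwuf : ∀ f : k⟦X⟧, w * (u * f) = f := fun f => by rw [← mul_assoc, hu, one_mul]
  have huwf : ∀ f : k⟦X⟧, u * (w * f) = f := fun f => by rw [← mul_assoc, mul_comm u, hu, one_mul]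
  let J : Ideal (semigroupRing k H) := Submodule.comap
    ((LinearMap.mulLeft (semigroupRing k H) w) ∘ₗ Algebra.linearMap (semigroupRing k H) k⟦X⟧)
    I.toSeries
  have hJ : ∀ v : k⟦X⟧, v ∈ J.toSeries ↔ v ∈ semigroupRing k H ∧ w * v ∈ I.toSeries := fun v => by
    rw [Ideal.mem_toSeries]
    exact ⟨fun ⟨h, h'⟩ => ⟨h, h'⟩, fun ⟨h, h'⟩ => ⟨h, h'⟩⟩
  have hJc : ContainsTail c J := fun v hv =>
    (hJ v).2 ⟨hc.mem_of_X_pow_dvd hv, hI _ (hv.mul_left w)⟩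
  refine ⟨J, isMonomialIdeal_of_forall hc hJc ?_, hJc.conductorIdeal_le hc, ⟨?_⟩⟩
  · intro f hf m hm hne
    have hmS : m ∈ S := by
      by_contra hmS
      apply hne
      rw [← huwf f]
      exact hsupp _ ((hJ f).1 hf).2 m hm hmS
    exact (hJ _).2 ⟨X_pow_mem_semigroupRing (hS hmS), h₂ m hmS⟩
  · have hto : ∀ y : I, (⟨u * (y : semigroupRing k H), hmem _ (Ideal.coe_mem_toSeries.2 y.2)⟩ :
        semigroupRing k H) ∈ J := fun y => by
      rw [← Ideal.coe_mem_toSeries, hJ]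
      refine ⟨hmem _ (Ideal.coe_mem_toSeries.2 y.2), ?_⟩
      rw [hwuf]
      exact Ideal.coe_mem_toSeries.2 y.2
    refine LinearEquiv.ofBijective ((I.mulSeries u hmem).codRestrict J hto) ⟨?_, ?_⟩
    · intro y z hyz
      have h : u * ((y : semigroupRing k H) : k⟦X⟧) = u * (z : semigroupRing k H) :=
        congrArg (fun x : J => ((x : semigroupRing k H) : k⟦X⟧)) hyz
      refine Subtype.ext (Subtype.ext ?_)
      rw [← hwuf (y : semigroupRing k H), h, hwuf]
    · intro z
      obtain ⟨hzR, hzI⟩ := Ideal.mem_toSeries.1 ((hJ _).1 (Ideal.coe_mem_toSeries.2 z.2)).2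
      exact ⟨⟨_, hzI⟩, Subtype.ext (Subtype.ext (huwf _))⟩

theorem finite_rankOneReflexiveClasses (hc : IsConductorExponent H c)
    (h : ∀ (M : Type u) [AddCommGroup M] [Module (semigroupRing k H) M],
      IsRankOneReflexive (semigroupRing k H) M →
        ∃ I : Ideal (semigroupRing k H), IsMonomialIdeal I ∧
          conductorIdeal (semigroupRing k H) ≤ I ∧ Nonempty (M ≃ₗ[semigroupRing k H] I)) :
    (rankOneReflexiveClasses (semigroupRing k H)).Finite := by
  refine finite_rankOneReflexiveClasses_of_finite (finite_monomialIdeals (k := k) hc)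
    fun M _ _ hM => ?_
  obtain ⟨I, hI, hI', he⟩ := h M hM
  exact ⟨I, ⟨hI, hI'⟩, he⟩

/-! ### Semigroups `{0, a, b, d, c, c + 1, …}` -/

/-- `H = {0 < a < b < d < c, c + 1, c + 2, …}` with `c - 1 ∉ H`. -/
structure IsFourGap (H : AddSubmonoid ℕ) (a b d c : ℕ) : Prop where
  pos : 0 < a
  a_lt : a < b
  b_lt : b < d
  d_lt : d + 1 < c
  mem_iff : ∀ m, m ∈ H ↔ m = 0 ∨ m = a ∨ m = b ∨ m = d ∨ c ≤ m

theorem ContainsTail.mem_of_dvd_sub {I : Ideal (semigroupRing k H)} (hI : ContainsTail c I)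
    {v w : k⟦X⟧} (hv : v ∈ I.toSeries) (h : X ^ c ∣ w - v) : w ∈ I.toSeries := by
  rw [← sub_add_cancel w v]
  exact add_mem (hI _ h) hv

theorem Ideal.C_mul_mem_toSeries {I : Ideal (semigroupRing k H)} (x : k) {v : k⟦X⟧}
    (hv : v ∈ I.toSeries) : C x * v ∈ I.toSeries :=
  Ideal.mul_mem_toSeries (C_mem_semigroupRing x) hv

theorem Ideal.exists_coeff_eq_one {I : Ideal (semigroupRing k H)} {e : ℕ}
    (h : ∃ g ∈ I.toSeries, coeff e g ≠ 0) : ∃ g ∈ I.toSeries, coeff e g = 1 := by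
  obtain ⟨g, hg, hge⟩ := h
  exact ⟨C (coeff e g)⁻¹ * g, Ideal.C_mul_mem_toSeries _ hg, by
    rw [coeff_C_mul, inv_mul_cancel₀ hge]⟩

theorem PowerSeries.exists_mul_eq_one {g : k⟦X⟧} (hg : coeff 0 g ≠ 0) : ∃ u, g * u = 1 := by
  rw [← isUnit_iff_exists_inv, PowerSeries.isUnit_iff_constantCoeff,
    ← coeff_zero_eq_constantCoeff_apply]
  exact isUnit_iff_ne_zero.2 hg

theorem Ideal.X_pow_mem_toSeries_of_coeff_zero_ne_zero {I : Ideal (semigroupRing k H)} {g : k⟦X⟧}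
    (hg : g ∈ I.toSeries) (hg0 : coeff 0 g ≠ 0) {m : ℕ} (hm : m ∈ H) : X ^ m ∈ I.toSeries := by
  obtain ⟨u, hu⟩ := PowerSeries.exists_mul_eq_one hg0
  have huR : u ∈ semigroupRing k H :=
    mem_of_mul_mem_of_coeff_zero_ne_zero (Ideal.mem_semigroupRing_of_mem_toSeries hg) hg0
      (by rw [mul_comm, hu]; exact one_mem _)
  have := Ideal.mul_mem_toSeries (mul_mem (X_pow_mem_semigroupRing hm) huR) hg
  rwa [mul_assoc, mul_comm u, hu, mul_one] at this

/-- An ideal generated modulo the conductor by one element is isomorphic to a monomial ideal. -/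
theorem exists_monomialIdeal_equiv_of_principal (hc : IsConductorExponent H c)
    {I : Ideal (semigroupRing k H)} (hI : ContainsTail c I) {e : ℕ} (he : e ∈ H) {g : k⟦X⟧}
    (hg : g ∈ I.toSeries) (hge : coeff e g = 1) (hdvd : X ^ e ∣ g)
    (h : ∀ f ∈ I.toSeries, X ^ c ∣ f - C (coeff e f) * g) :
    ∃ J : Ideal (semigroupRing k H), IsMonomialIdeal J ∧
      conductorIdeal (semigroupRing k H) ≤ J ∧ Nonempty (I ≃ₗ[semigroupRing k H] J) := by
  obtain ⟨w, rfl⟩ := hdvd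
  rw [coeff_X_pow_mul', if_pos le_rfl, Nat.sub_self] at hge
  refine exists_monomialIdeal_equiv hc hI w (by rw [hge]; exact one_ne_zero) {e}
    (fun f hf => ⟨C (coeff e f) * X ^ e, fun m _ hm => ?_, ?_⟩) ?_ (by simpa using he)
  · rw [coeff_C_mul, coeff_X_pow, if_neg (by simpa using hm), mul_zero]
  · convert h f hf using 1
    ring
  · rintro s rfl
    rwa [mul_comm]

theorem PowerSeries.coeff_mul_X_pow_add (f : k⟦X⟧) (x : k) (e e' m : ℕ) :
    coeff m (f * (X ^ e + C x * X ^ e')) =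
      (if e ≤ m then coeff (m - e) f else 0) + x * (if e' ≤ m then coeff (m - e') f else 0) := by
  rw [mul_add, map_add, coeff_mul_X_pow', mul_left_comm, coeff_C_mul, coeff_mul_X_pow']

namespace IsFourGap

variable {a b d : ℕ} (h : IsFourGap H a b d c)
include h

theorem isConductorExponent : IsConductorExponent H c where
  mem_of_le m hm := (h.mem_iff m).2 (by omega)
  pred_notMem := ⟨c - 1, by have := h.d_lt; omega, fun hm => by
    have := (h.mem_iff _).1 hm
    have := h.pos
    have := h.a_lt
    have := h.b_lt
    have := h.d_lt
    omega⟩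

theorem a_mem : a ∈ H := (h.mem_iff a).2 (by omega)

theorem b_mem : b ∈ H := (h.mem_iff b).2 (by omega)

theorem d_mem : d ∈ H := (h.mem_iff d).2 (by omega)

theorem X_pow_dvd {f : k⟦X⟧} (hf : f ∈ semigroupRing k H) {n : ℕ} (hn : n ≤ c)
    (h0 : coeff 0 f = 0) (ha : n ≤ a ∨ coeff a f = 0) (hb : n ≤ b ∨ coeff b f = 0)
    (hd : n ≤ d ∨ coeff d f = 0) : X ^ n ∣ f := by
  rw [X_pow_dvd_iff]
  intro m hm
  by_cases hmH : m ∈ H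
  · rcases (h.mem_iff m).1 hmH with rfl | rfl | rfl | rfl | hm'
    · exact h0
    · exact ha.resolve_left (by omega)
    · exact hb.resolve_left (by omega)
    · exact hd.resolve_left (by omega)
    · omega
  · exact hf m hmH

theorem mem_of_coeff_eq {I : Ideal (semigroupRing k H)} (hI : ContainsTail c I)
    {v w : k⟦X⟧} (hv : v ∈ I.toSeries) (hw : w ∈ semigroupRing k H)
    (h0 : coeff 0 w = coeff 0 v) (ha : coeff a w = coeff a v) (hb : coeff b w = coeff b v)
    (hd : coeff d w = coeff d v) : w ∈ I.toSeries := by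
  refine hI.mem_of_dvd_sub hv (h.X_pow_dvd
    (sub_mem hw (Ideal.mem_semigroupRing_of_mem_toSeries hv)) le_rfl ?_ (Or.inr ?_) (Or.inr ?_)
    (Or.inr ?_)) <;> rw [map_sub, sub_eq_zero] <;> assumption

theorem ne : a ≠ 0 ∧ b ≠ 0 ∧ d ≠ 0 ∧ 0 ≠ a ∧ 0 ≠ b ∧ 0 ≠ d ∧ a ≠ b ∧ a ≠ d ∧ b ≠ d ∧ b ≠ a ∧
    d ≠ a ∧ d ≠ b := by
  have := h.pos
  have := h.a_lt
  have := h.b_lt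
  omega

theorem X_pow_d_mem {I : Ideal (semigroupRing k H)} (hI : ContainsTail c I) {f : k⟦X⟧}
    (hf : f ∈ I.toSeries) (h0 : coeff 0 f = 0) (ha : coeff a f = 0) (hb : coeff b f = 0)
    (hd : coeff d f ≠ 0) : X ^ d ∈ I.toSeries := by
  refine h.mem_of_coeff_eq hI (Ideal.C_mul_mem_toSeries (coeff d f)⁻¹ hf)
    (X_pow_mem_semigroupRing h.d_mem) ?_ ?_ ?_ ?_ <;>
  simp only [coeff_C_mul, coeff_X_pow, h.ne, h0, ha, hb, mul_zero, if_true, if_false,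
    inv_mul_cancel₀ hd]

theorem X_pow_b_mem {I : Ideal (semigroupRing k H)} (hI : ContainsTail c I) {f : k⟦X⟧}
    (hf : f ∈ I.toSeries) (h0 : coeff 0 f = 0) (ha : coeff a f = 0) (hb : coeff b f ≠ 0)
    (hd : X ^ d ∈ I.toSeries) : X ^ b ∈ I.toSeries := by
  refine h.mem_of_coeff_eq hI (Ideal.C_mul_mem_toSeries (coeff b f)⁻¹
    (sub_mem hf (Ideal.C_mul_mem_toSeries (coeff d f) hd)))
    (X_pow_mem_semigroupRing h.b_mem) ?_ ?_ ?_ ?_ <;>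
  simp [coeff_C_mul, coeff_X_pow, h.ne, ha, inv_mul_cancel₀ hb, -coeff_zero_eq_constantCoeff, h0]

theorem X_pow_a_mem {I : Ideal (semigroupRing k H)} (hI : ContainsTail c I) {f : k⟦X⟧}
    (hf : f ∈ I.toSeries) (h0 : coeff 0 f = 0) (ha : coeff a f ≠ 0) (hb : X ^ b ∈ I.toSeries)
    (hd : X ^ d ∈ I.toSeries) : X ^ a ∈ I.toSeries := by
  refine h.mem_of_coeff_eq hI (Ideal.C_mul_mem_toSeries (coeff a f)⁻¹
    (sub_mem (sub_mem hf (Ideal.C_mul_mem_toSeries (coeff d f) hd))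
      (Ideal.C_mul_mem_toSeries (coeff b f) hb)))
    (X_pow_mem_semigroupRing h.a_mem) ?_ ?_ ?_ ?_ <;>
  simp [coeff_C_mul, coeff_X_pow, h.ne, inv_mul_cancel₀ ha, -coeff_zero_eq_constantCoeff, h0]

/-- A coefficient below the conductor of an element of the ring that vanishes at `0`. -/
theorem eq_of_coeff_ne_zero {f : k⟦X⟧} (hf : f ∈ semigroupRing k H) (h0 : coeff 0 f = 0) {m : ℕ}
    (hm : m < c) (hne : coeff m f ≠ 0) : m = a ∨ m = b ∨ m = d := by
  have hmH : m ∈ H := by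
    by_contra hmH
    exact hne (hf m hmH)
  rcases (h.mem_iff m).1 hmH with rfl | hm' | hm' | hm' | hm'
  · exact absurd h0 hne
  all_goals omega

/-! #### Trace ideals when `c ≤ b - a + d` -/

/-- Explicit multipliers in `R : I` carry an element of least order to the missing monomials, and
stability puts these into `I`. -/
theorem X_pow_mem_of_isColonStable (hi : c + a ≤ b + d) {I : Ideal (semigroupRing k H)}
    (hI : ContainsTail c I) (hst : IsColonStable I) :
    ∀ f ∈ I.toSeries, ∀ m < c, coeff m f ≠ 0 → X ^ m ∈ I.toSeries := by
  have hpos := h.pos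
  have hab := h.a_lt
  have hbd := h.b_lt
  have hdc := h.d_lt
  have hc := h.isConductorExponent
  have hR : ∀ {f : k⟦X⟧}, f ∈ I.toSeries → f ∈ semigroupRing k H :=
    fun hf => Ideal.mem_semigroupRing_of_mem_toSeries hf
  -- With `g = X ^ e * w`, the multiplier `X ^ (e' - e) / w` sends `g` to `X ^ e'` and multiples of
  -- `X ^ n` into the tail, so it lies in `R : I`.
  have key : ∀ e e' n, e ≤ e' → c ≤ e' - e + n → e' ∈ H → ∀ g ∈ I.toSeries, X ^ e ∣ g →
      coeff e g = 1 → (∀ y ∈ I.toSeries, X ^ n ∣ y - C (coeff e y) * g) →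
      X ^ e' ∈ I.toSeries := by
    rintro e e' n hee hn he' g hg ⟨w, rfl⟩ hge hdvd
    rw [coeff_X_pow_mul', if_pos le_rfl, Nat.sub_self] at hge
    obtain ⟨u, hu⟩ := PowerSeries.exists_mul_eq_one (g := w) (by rw [hge]; exact one_ne_zero)
    have hX : X ^ (e' - e) * X ^ e = (X ^ e' : k⟦X⟧) := by rw [← pow_add, Nat.sub_add_cancel hee]
    have hfg : X ^ (e' - e) * u * (X ^ e * w) = X ^ e' := by
      linear_combination X ^ (e' - e) * X ^ e * hu + hX
    rw [← hfg]
    refine hst _ (fun y hy => ?_) _ hg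
    have : X ^ (e' - e) * u * y = C (coeff e y) * X ^ e' +
        X ^ (e' - e) * u * (y - C (coeff e y) * (X ^ e * w)) := by
      linear_combination C (coeff e y) * hfg
    rw [this]
    refine add_mem (mul_mem (C_mem_semigroupRing _) (X_pow_mem_semigroupRing he'))
      (hc.mem_of_X_pow_dvd ?_)
    exact (pow_dvd_pow X hn).trans ((pow_add (X : k⟦X⟧) _ _).symm ▸
      mul_dvd_mul (dvd_mul_right _ _) (hdvd y hy))
  intro f hf m hm hne
  by_cases H0 : ∃ g ∈ I.toSeries, coeff 0 g ≠ 0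
  · obtain ⟨g, hg, hg0⟩ := H0
    refine Ideal.X_pow_mem_toSeries_of_coeff_zero_ne_zero hg hg0 ?_
    by_contra hmH
    exact hne (hR hf m hmH)
  push Not at H0
  have hsubR : ∀ y ∈ I.toSeries, ∀ g ∈ I.toSeries, ∀ e, y - C (coeff e y) * g ∈ I.toSeries :=
    fun y hy g hg e => sub_mem hy (Ideal.C_mul_mem_toSeries _ hg)
  have hsub : ∀ y ∈ I.toSeries, ∀ g ∈ I.toSeries, ∀ e, coeff e g = 1 →
      coeff e (y - C (coeff e y) * g) = 0 := fun y _ g _ e he => by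
    rw [map_sub, coeff_C_mul, he, mul_one, sub_self]
  by_cases Ha : ∃ g ∈ I.toSeries, coeff a g ≠ 0
  · obtain ⟨g, hg, hga⟩ := Ideal.exists_coeff_eq_one Ha
    have hXg : X ^ a ∣ g := h.X_pow_dvd (hR hg) (by omega) (H0 g hg) (Or.inl le_rfl)
      (Or.inl (by omega)) (Or.inl (by omega))
    have hd : X ^ d ∈ I.toSeries := key a d b (by omega) (by omega) h.d_mem g hg hXg hga
      fun y hy => h.X_pow_dvd (hR (hsubR y hy g hg a)) (by omega) (H0 _ (hsubR y hy g hg a))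
        (Or.inr (hsub y hy g hg a hga)) (Or.inl le_rfl) (Or.inl (by omega))
    -- Assuming `X ^ b ∉ I` improves the precision: every element is then a multiple of `g` modulo
    -- `X ^ d`, which is what `key` needs.
    have hb : X ^ b ∈ I.toSeries := by
      by_contra hb
      refine hb (key a b d (by omega) (by omega) h.b_mem g hg hXg hga
        fun y hy => h.X_pow_dvd (hR (hsubR y hy g hg a)) (by omega) (H0 _ (hsubR y hy g hg a))
        (Or.inr (hsub y hy g hg a hga)) (Or.inr ?_) (Or.inl le_rfl))
      by_contra hne'
      exact hb (h.X_pow_b_mem hI (hsubR y hy g hg a) (H0 _ (hsubR y hy g hg a))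
        (hsub y hy g hg a hga) hne' hd)
    rcases h.eq_of_coeff_ne_zero (hR hf) (H0 f hf) hm hne with rfl | rfl | rfl
    · exact h.X_pow_a_mem hI hf (H0 f hf) hne hb hd
    · exact hb
    · exact hd
  push Not at Ha
  by_cases Hb : ∃ g ∈ I.toSeries, coeff b g ≠ 0
  · obtain ⟨g, hg, hgb⟩ := Ideal.exists_coeff_eq_one Hb
    have hXg : X ^ b ∣ g := h.X_pow_dvd (hR hg) (by omega) (H0 g hg) (Or.inr (Ha g hg))
      (Or.inl le_rfl) (Or.inl (by omega))
    have hd : X ^ d ∈ I.toSeries := by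
      by_contra hd
      refine hd (key b d c (by omega) (by omega) h.d_mem g hg hXg hgb
        fun y hy => h.X_pow_dvd (hR (hsubR y hy g hg b)) (by omega) (H0 _ (hsubR y hy g hg b))
        (Or.inr (Ha _ (hsubR y hy g hg b))) (Or.inr (hsub y hy g hg b hgb)) (Or.inr ?_))
      by_contra hne'
      exact hd (h.X_pow_d_mem hI (hsubR y hy g hg b) (H0 _ (hsubR y hy g hg b))
        (Ha _ (hsubR y hy g hg b)) (hsub y hy g hg b hgb) hne')
    rcases h.eq_of_coeff_ne_zero (hR hf) (H0 f hf) hm hne with rfl | rfl | rfl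
    · exact absurd (Ha f hf) hne
    · exact h.X_pow_b_mem hI hf (H0 f hf) (Ha f hf) hne hd
    · exact hd
  push Not at Hb
  rcases h.eq_of_coeff_ne_zero (hR hf) (H0 f hf) hm hne with rfl | rfl | rfl
  · exact absurd (Ha f hf) hne
  · exact absurd (Hb f hf) hne
  · exact h.X_pow_d_mem hI hf (H0 f hf) (Ha f hf) (Hb f hf) hne

theorem finite_regularTraceIdeals (hi : c + a ≤ b + d) :
    (regularTraceIdeals (semigroupRing k H)).Finite := by
  have hc := h.isConductorExponent
  refine (finite_monomialIdeals hc).subset fun I hI => ?_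
  have hI' := containsTail_of_mem_regularTraceIdeals hc hI
  exact ⟨isMonomialIdeal_of_forall hc hI'
    (h.X_pow_mem_of_isColonStable hi hI' (isColonStable_of_mem_regularTraceIdeals hI)),
    hI'.conductorIdeal_le hc⟩

/-! #### Reflexive ideals -/

theorem notMem_of_lt {m : ℕ} (h0 : 0 < m) (ha : m ≠ a) (hb : m ≠ b) (hd : m ≠ d) (hc : m < c) :
    m ∉ H := fun hm => by
  have := (h.mem_iff m).1 hm
  omega

theorem mul_X_pow_mem {f : k⟦X⟧} {e : ℕ} (he : e ∈ H)
    (hf : ∀ i, 0 < i → e + i < c → coeff i f = 0) : f * X ^ e ∈ semigroupRing k H := by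
  intro m hm
  rw [coeff_mul_X_pow']
  split_ifs with hem
  · have hne : m ≠ e := by
      rintro rfl
      exact hm he
    exact hf _ (by omega) (by
      have := not_le.1 fun h' => hm (h.isConductorExponent.mem_of_le m h')
      omega)
  · rfl

/-- If `d + i < c` then `a + i < b` by (i), so the equation of `f * g` at the gap `a + i` involves
`f_i` alone. Hence `f * X ^ d ∈ R` for every multiplier `f`. -/
theorem X_pow_d_mem_of_isColonReflexive (hi : c + a ≤ b + d) {I : Ideal (semigroupRing k H)}
    (hI : IsColonReflexive I) {g : k⟦X⟧} (hg : g ∈ I.toSeries) (hg0 : coeff 0 g = 0)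
    (hga : coeff a g = 1) : X ^ d ∈ I.toSeries := by
  have := h.pos
  have := h.a_lt
  have := h.b_lt
  refine hI _ fun f hf => h.mul_X_pow_mem h.d_mem fun i hi0 hic => ?_
  have hgR := Ideal.mem_semigroupRing_of_mem_toSeries hg
  have hfg := hf g hg (a + i) (h.notMem_of_lt (by omega) (by omega) (by omega) (by omega) (by omega))
  rw [coeff_mul, Finset.sum_eq_single (i, a)] at hfg
  · rwa [hga, mul_one] at hfg
  · rintro ⟨i', j⟩ hij hne
    rw [Finset.HasAntidiagonal.mem_antidiagonal] at hij
    simp only at hij ⊢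
    have hj : coeff j g = 0 := by
      by_cases hj0 : j = 0
      · rw [hj0, hg0]
      · refine hgR j (h.notMem_of_lt (by omega) ?_ (by omega) (by omega) (by omega))
        rintro rfl
        exact hne (by rw [show i' = i by omega])
    rw [hj, mul_zero]
  · intro h'
    exact absurd (Finset.HasAntidiagonal.mem_antidiagonal.2 (add_comm _ _)) h'

theorem coeff_relation {f : k⟦X⟧} {x : k} {e e' : ℕ}
    (hf : f * (X ^ e + C x * X ^ e') ∈ semigroupRing k H) (i : ℕ) (hi : 0 < i)
    (ha : e + i ≠ a) (hb : e + i ≠ b) (hd : e + i ≠ d) (hc : e + i < c) :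
    coeff i f + x * (if e' ≤ e + i then coeff (e + i - e') f else 0) = 0 := by
  have := hf (e + i) (h.notMem_of_lt (by omega) ha hb hd hc)
  rwa [PowerSeries.coeff_mul_X_pow_add, if_pos (by omega), Nat.add_sub_cancel_left] at this

/-- The positions `a + i = b, d` give no gap equation, but (ii) gives `d - a < c - d`, so `f * X ^ d
∈ R` already kills those `f_i`. The rest follows by induction. -/
theorem coeff_eq_zero_of_mul_mem_ab (hii : 2 * d < c + a) {f : k⟦X⟧} {x : k}
    (hd : f * X ^ d ∈ semigroupRing k H) (hab : f * (X ^ a + C x * X ^ b) ∈ semigroupRing k H) :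
    ∀ i, 0 < i → a + i < c → coeff i f = 0 := by
  have := h.pos
  have := h.a_lt
  have := h.b_lt
  have hd' : ∀ i, 0 < i → d + i < c → coeff i f = 0 := by
    intro i hi hic
    have := hd (d + i) (h.notMem_of_lt (by omega) (by omega) (by omega) (by omega) hic)
    rwa [coeff_mul_X_pow', if_pos (by omega), Nat.add_sub_cancel_left] at this
  intro i
  induction i using Nat.strong_induction_on with
  | _ i ih =>
    intro hi hic
    by_cases hib : a + i = b
    · exact hd' i hi (by omega)
    by_cases hid : a + i = d
    · exact hd' i hi (by omega)
    have hrel := h.coeff_relation hab i hi (by omega) hib hid hic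
    split_ifs at hrel with hle
    · rwa [ih (a + i - b) (by omega) (by omega) (by omega), mul_zero, add_zero] at hrel
    · rwa [mul_zero, add_zero] at hrel

/-- Once `f_(b-a)` and `f_(d-a)` vanish, the first relation kills the other coefficients by
induction. For an arithmetic progression of step `δ`, the relations at `2δ` and `3δ` combine to `(x
+ y ^ 2) f_δ = 0`, the only obstruction. -/
theorem coeff_eq_zero_of_mul_mem_ad_bd (hii : 2 * d < c + a) {f : k⟦X⟧} {x y : k}
    (had : f * (X ^ a + C x * X ^ d) ∈ semigroupRing k H)
    (hbd : f * (X ^ b + C y * X ^ d) ∈ semigroupRing k H)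
    (hxy : d + a = 2 * b → x + y ^ 2 ≠ 0) :
    ∀ i, 0 < i → a + i < c → coeff i f = 0 := by
  have := h.pos
  have := h.a_lt
  have := h.b_lt
  have P := h.coeff_relation had
  have Q := h.coeff_relation hbd
  have key : coeff (b - a) f = 0 ∧ coeff (d - a) f = 0 := by
    by_cases hap : d + a = 2 * b
    · obtain ⟨δ, rfl⟩ : ∃ δ, b = a + δ := ⟨b - a, by omega⟩
      obtain rfl : d = a + 2 * δ := by omega
      have h2 := Q (2 * δ) (by omega) (by omega) (by omega) (by omega) (by omega)
      have h3 := Q (3 * δ) (by omega) (by omega) (by omega) (by omega) (by omega)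
      have h3' := P (3 * δ) (by omega) (by omega) (by omega) (by omega) (by omega)
      rw [if_pos (by omega), show a + δ + 2 * δ - (a + 2 * δ) = δ by omega] at h2
      rw [if_pos (by omega), show a + δ + 3 * δ - (a + 2 * δ) = 2 * δ by omega] at h3
      rw [if_pos (by omega), show a + 3 * δ - (a + 2 * δ) = δ by omega] at h3'
      have h1 : coeff δ f = 0 := by
        have : (x + y ^ 2) * coeff δ f = 0 := by linear_combination h3' - h3 + y * h2
        exact (mul_eq_zero.1 this).resolve_left (hxy hap)
      rw [show a + δ - a = δ by omega, show a + 2 * δ - a = 2 * δ by omega]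
      rw [h1, mul_zero, add_zero] at h2
      exact ⟨h1, h2⟩
    -- Here `2b - a ≠ d` is a gap. If a correction term `f_(2b-a-d)` occurs, its index is so small
    -- that the first relation kills it outright.
    · have h1 : coeff (b - a) f = 0 := by
        have hQ := Q (b - a) (by omega) (by omega) (by omega) (by omega) (by omega)
        split_ifs at hQ with hle
        · have hP := P (b + (b - a) - d) (by omega) (by omega) (by omega) (by omega) (by omega)
          rw [if_neg (by omega), mul_zero, add_zero] at hP
          rwa [hP, mul_zero, add_zero] at hQ
        · rwa [mul_zero, add_zero] at hQ
      have h2 := Q (d - a) (by omega) (by omega) (by omega) (by omega) (by omega)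
      rw [if_pos (by omega), show b + (d - a) - d = b - a by omega, h1, mul_zero, add_zero] at h2
      exact ⟨h1, h2⟩
  intro i
  induction i using Nat.strong_induction_on with
  | _ i ih =>
    intro hi hic
    by_cases hib : a + i = b
    · rw [show i = b - a by omega]
      exact key.1
    by_cases hid : a + i = d
    · rw [show i = d - a by omega]
      exact key.2
    have hrel := P i hi (by omega) hib hid hic
    split_ifs at hrel with hle
    · rwa [ih (a + i - d) (by omega) (by omega) (by omega), mul_zero, add_zero] at hrel
    · rwa [mul_zero, add_zero] at hrel

/-! ### Bringing reflexive ideals to monomial form -/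

theorem exists_monomialIdeal_equiv_of_coeff {I : Ideal (semigroupRing k H)}
    (hI : ContainsTail c I)
    (hm : ∀ f ∈ I.toSeries, ∀ m < c, coeff m f ≠ 0 → X ^ m ∈ I.toSeries) :
    ∃ J : Ideal (semigroupRing k H), IsMonomialIdeal J ∧
      conductorIdeal (semigroupRing k H) ≤ J ∧ Nonempty (I ≃ₗ[semigroupRing k H] J) :=
  ⟨I, isMonomialIdeal_of_forall h.isConductorExponent hI hm,
    hI.conductorIdeal_le h.isConductorExponent, ⟨LinearEquiv.refl _ _⟩⟩

theorem exists_monomialIdeal_equiv_of_b_mem {I : Ideal (semigroupRing k H)}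
    (hI : ContainsTail c I) (h0 : ∀ f ∈ I.toSeries, coeff 0 f = 0) (hb : X ^ b ∈ I.toSeries)
    (hd : X ^ d ∈ I.toSeries) :
    ∃ J : Ideal (semigroupRing k H), IsMonomialIdeal J ∧
      conductorIdeal (semigroupRing k H) ≤ J ∧ Nonempty (I ≃ₗ[semigroupRing k H] J) := by
  refine h.exists_monomialIdeal_equiv_of_coeff hI fun f hf m hm hne => ?_
  rcases h.eq_of_coeff_ne_zero (Ideal.mem_semigroupRing_of_mem_toSeries hf) (h0 f hf) hm hne
    with rfl | rfl | rfl
  · exact h.X_pow_a_mem hI hf (h0 f hf) hne hb hd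
  · exact hb
  · exact hd

/-- Ideals all of whose elements have vanishing coefficients at `0` and `a`. -/
theorem exists_monomialIdeal_equiv_of_coeff_a {I : Ideal (semigroupRing k H)}
    (hI : ContainsTail c I) (h0 : ∀ f ∈ I.toSeries, coeff 0 f = 0)
    (ha : ∀ f ∈ I.toSeries, coeff a f = 0) :
    ∃ J : Ideal (semigroupRing k H), IsMonomialIdeal J ∧
      conductorIdeal (semigroupRing k H) ≤ J ∧ Nonempty (I ≃ₗ[semigroupRing k H] J) := by
  have := h.pos
  have := h.a_lt
  have := h.b_lt
  have := h.d_lt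
  have hR : ∀ {f : k⟦X⟧}, f ∈ I.toSeries → f ∈ semigroupRing k H :=
    fun hf => Ideal.mem_semigroupRing_of_mem_toSeries hf
  by_cases hd : X ^ d ∈ I.toSeries
  · refine h.exists_monomialIdeal_equiv_of_coeff hI fun f hf m hm hne => ?_
    rcases h.eq_of_coeff_ne_zero (hR hf) (h0 f hf) hm hne with rfl | rfl | rfl
    · exact absurd (ha f hf) hne
    · exact h.X_pow_b_mem hI hf (h0 f hf) (ha f hf) hne hd
    · exact hd
  have hbd : ∀ f ∈ I.toSeries, coeff b f = 0 → coeff d f = 0 := fun f hf hb => by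
    by_contra hne
    exact hd (h.X_pow_d_mem hI hf (h0 f hf) (ha f hf) hb hne)
  by_cases Hb : ∃ g ∈ I.toSeries, coeff b g ≠ 0
  · obtain ⟨g, hg, hgb⟩ := Ideal.exists_coeff_eq_one Hb
    refine exists_monomialIdeal_equiv_of_principal h.isConductorExponent hI h.b_mem hg hgb
      (h.X_pow_dvd (hR hg) (by omega) (h0 g hg) (Or.inr (ha g hg)) (Or.inl le_rfl)
        (Or.inl (by omega))) fun f hf => ?_
    have hf' := sub_mem hf (Ideal.C_mul_mem_toSeries (coeff b f) hg)
    have hb' : coeff b (f - C (coeff b f) * g) = 0 := by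
      rw [map_sub, coeff_C_mul, hgb, mul_one, sub_self]
    exact h.X_pow_dvd (hR hf') le_rfl (h0 _ hf') (Or.inr (ha _ hf')) (Or.inr hb')
      (Or.inr (hbd _ hf' hb'))
  · push Not at Hb
    refine h.exists_monomialIdeal_equiv_of_coeff hI fun f hf m hm hne => ?_
    rcases h.eq_of_coeff_ne_zero (hR hf) (h0 f hf) hm hne with rfl | rfl | rfl
    · exact absurd (ha f hf) hne
    · exact absurd (Hb f hf) hne
    · exact absurd (hbd f hf (Hb f hf)) hne

/-- Ideals that are generated by `X ^ a + x X ^ b`, `X ^ d` modulo the conductor. -/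
theorem exists_monomialIdeal_equiv_of_d_mem (hi : c + a ≤ b + d) {I : Ideal (semigroupRing k H)}
    (hI : ContainsTail c I) (h0 : ∀ f ∈ I.toSeries, coeff 0 f = 0) (hd : X ^ d ∈ I.toSeries)
    {g : k⟦X⟧} (hg : g ∈ I.toSeries) (hga : coeff a g = 1) :
    ∃ J : Ideal (semigroupRing k H), IsMonomialIdeal J ∧
      conductorIdeal (semigroupRing k H) ≤ J ∧ Nonempty (I ≃ₗ[semigroupRing k H] J) := by
  have := h.pos
  have := h.a_lt
  have := h.b_lt
  have := h.d_lt
  have hR : ∀ {f : k⟦X⟧}, f ∈ I.toSeries → f ∈ semigroupRing k H :=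
    fun hf => Ideal.mem_semigroupRing_of_mem_toSeries hf
  by_cases hb : X ^ b ∈ I.toSeries
  · exact h.exists_monomialIdeal_equiv_of_b_mem hI h0 hb hd
  have hfb : ∀ f ∈ I.toSeries, coeff b f = coeff a f * coeff b g := by
    intro f hf
    by_contra hne
    have hf' := sub_mem hf (Ideal.C_mul_mem_toSeries (coeff a f) hg)
    refine hb (h.X_pow_b_mem hI hf' (h0 _ hf') ?_ ?_ hd)
    · rw [map_sub, coeff_C_mul, hga, mul_one, sub_self]
    · rw [map_sub, coeff_C_mul]
      exact sub_ne_zero.2 hne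
  have hXb : X ^ (b - a) * X ^ a = (X ^ b : k⟦X⟧) := by
    rw [← pow_add, Nat.sub_add_cancel (by omega)]
  have hXd : X ^ (b - a) * X ^ d = (X ^ (b + d - a) : k⟦X⟧) := by
    rw [← pow_add]
    congr 1
    omega
  have hdvd : X ^ c ∣ (X ^ (b + d - a) : k⟦X⟧) := pow_dvd_pow _ (by omega)
  -- The unit is `(X ^ a + x X ^ b) / X ^ a` with `x = coeff b g`; it fixes `X ^ d` modulo the tail
  -- by (i).
  refine exists_monomialIdeal_equiv h.isConductorExponent hI (1 + C (coeff b g) * X ^ (b - a))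
    ?_ {a, d} (fun f hf => ⟨C (coeff a f) * X ^ a + C (coeff d f) * X ^ d, ?_, ?_⟩) ?_ ?_
  · rw [map_add, coeff_C_mul, coeff_X_pow, if_neg (by omega), coeff_zero_one]
    simp
  · intro m _ hm
    simp only [Set.mem_insert_iff, Set.mem_singleton_iff, not_or] at hm
    simp only [map_add, coeff_C_mul, coeff_X_pow, hm, if_false, mul_zero, add_zero]
  · have hsplit : f - (1 + C (coeff b g) * X ^ (b - a)) *
        (C (coeff a f) * X ^ a + C (coeff d f) * X ^ d) =
        (f - (C (coeff a f) * X ^ a + C (coeff a f) * (C (coeff b g) * X ^ b) +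
          C (coeff d f) * X ^ d)) - C (coeff b g) * C (coeff d f) * X ^ (b + d - a) := by
      linear_combination (-C (coeff b g) * C (coeff a f)) * hXb -
        C (coeff b g) * C (coeff d f) * hXd
    rw [hsplit]
    refine dvd_sub (h.X_pow_dvd (sub_mem (hR hf) ?_) le_rfl ?_ (Or.inr ?_) (Or.inr ?_) (Or.inr ?_))
      (hdvd.mul_left _)
    · exact add_mem (add_mem (mul_mem (C_mem_semigroupRing _) (X_pow_mem_semigroupRing h.a_mem))
        (mul_mem (C_mem_semigroupRing _) (mul_mem (C_mem_semigroupRing _)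
          (X_pow_mem_semigroupRing h.b_mem))))
        (mul_mem (C_mem_semigroupRing _) (X_pow_mem_semigroupRing h.d_mem))
    all_goals simp only [map_sub, map_add, coeff_C_mul, coeff_X_pow, h.ne, if_true, if_false,
      h0 f hf, hfb f hf, mul_zero, mul_one, add_zero, zero_add, sub_self]
  · rintro s (rfl | rfl)
    · refine h.mem_of_coeff_eq hI (sub_mem hg (Ideal.C_mul_mem_toSeries (coeff d g) hd)) ?_ ?_ ?_ ?_
        ?_
      · rw [add_mul, one_mul, mul_assoc, hXb]
        exact add_mem (X_pow_mem_semigroupRing h.a_mem)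
          (mul_mem (C_mem_semigroupRing _) (X_pow_mem_semigroupRing h.b_mem))
      all_goals
        rw [add_mul, one_mul, mul_assoc, hXb]
        simp only [map_sub, map_add, coeff_C_mul, coeff_X_pow, h.ne, if_true, if_false,
          h0 g hg, hga, mul_zero, mul_one, add_zero, zero_add, sub_self, sub_zero]
    · rw [add_mul, one_mul, mul_assoc, hXd]
      exact add_mem hd (hI _ (hdvd.mul_left _))
  · rintro s (rfl | rfl)
    · exact h.a_mem
    · exact h.d_mem

/-- Ideals that are generated by `X ^ a - y ^ 2 X ^ d`, `X ^ b + y X ^ d` modulo the conductor,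
where `a, b, d` is an arithmetic progression. -/
theorem exists_monomialIdeal_equiv_of_arith (hap : d + a = 2 * b) {I : Ideal (semigroupRing k H)}
    (hI : ContainsTail c I) (h0 : ∀ f ∈ I.toSeries, coeff 0 f = 0) {y : k}
    (hg₁ : X ^ a + C (-y ^ 2) * X ^ d ∈ I.toSeries) (hg₂ : X ^ b + C y * X ^ d ∈ I.toSeries)
    (hd : X ^ d ∉ I.toSeries) :
    ∃ J : Ideal (semigroupRing k H), IsMonomialIdeal J ∧
      conductorIdeal (semigroupRing k H) ≤ J ∧ Nonempty (I ≃ₗ[semigroupRing k H] J) := by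
  have := h.pos
  have := h.a_lt
  have := h.b_lt
  have := h.d_lt
  have hR : ∀ {f : k⟦X⟧}, f ∈ I.toSeries → f ∈ semigroupRing k H :=
    fun hf => Ideal.mem_semigroupRing_of_mem_toSeries hf
  have hXb : X ^ (b - a) * X ^ a = (X ^ b : k⟦X⟧) := by
    rw [← pow_add, Nat.sub_add_cancel (by omega)]
  have hXd : X ^ (b - a) * X ^ b = (X ^ d : k⟦X⟧) := by
    rw [← pow_add]
    congr 1
    omega
  -- The unit `1 + y X ^ (b - a)` times `X ^ b` is the second generator, and times `X ^ a` it is the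
  -- first plus `y` times the second.
  refine exists_monomialIdeal_equiv h.isConductorExponent hI (1 + C y * X ^ (b - a))
    ?_ {a, b} (fun f hf => ⟨C (coeff a f) * X ^ a + C (coeff b f - y * coeff a f) * X ^ b, ?_, ?_⟩)
    ?_ ?_
  · rw [map_add, coeff_C_mul, coeff_X_pow, if_neg (by omega), coeff_zero_one]
    simp
  · intro m _ hm
    simp only [Set.mem_insert_iff, Set.mem_singleton_iff, not_or] at hm
    simp only [map_add, coeff_C_mul, coeff_X_pow, hm, if_false, mul_zero, add_zero]
  · have hsplit : f - (1 + C y * X ^ (b - a)) *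
        (C (coeff a f) * X ^ a + C (coeff b f - y * coeff a f) * X ^ b) =
        f - (C (coeff a f) * (X ^ a + C (-y ^ 2) * X ^ d) +
          C (coeff b f) * (X ^ b + C y * X ^ d)) := by
      simp only [map_sub, map_mul, map_neg, map_pow]
      linear_combination (-C y * C (coeff a f)) * hXb -
        C y * (C (coeff b f) - C y * C (coeff a f)) * hXd
    rw [hsplit]
    have hf' := sub_mem hf (add_mem (Ideal.C_mul_mem_toSeries (coeff a f) hg₁)
      (Ideal.C_mul_mem_toSeries (coeff b f) hg₂))
    set f' := f - (C (coeff a f) * (X ^ a + C (-y ^ 2) * X ^ d) +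
      C (coeff b f) * (X ^ b + C y * X ^ d)) with hf'_def
    have ha' : coeff a f' = 0 := by
      simp only [hf'_def, map_sub, map_add, coeff_C_mul, coeff_X_pow, h.ne, if_true, if_false,
        mul_zero, mul_one, add_zero, sub_self]
    have hb' : coeff b f' = 0 := by
      simp only [hf'_def, map_sub, map_add, coeff_C_mul, coeff_X_pow, h.ne, if_true, if_false,
        mul_zero, mul_one, add_zero, zero_add, sub_self]
    have hd' : coeff d f' = 0 := by
      by_contra hne
      exact hd (h.X_pow_d_mem hI hf' (h0 _ hf') ha' hb' hne)
    exact h.X_pow_dvd (hR hf') le_rfl (h0 _ hf') (Or.inr ha') (Or.inr hb') (Or.inr hd')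
  · rintro s (rfl | rfl)
    · convert add_mem hg₁ (Ideal.C_mul_mem_toSeries y hg₂) using 1
      simp only [map_neg, map_pow]
      linear_combination C y * hXb
    · convert hg₂ using 1
      linear_combination C y * hXd
  · rintro s (rfl | rfl)
    · exact h.a_mem
    · exact h.b_mem

theorem exists_monomialIdeal_equiv_of_isColonReflexive (hcond : c + a ≤ b + d ∨ 2 * d < c + a)
    {I : Ideal (semigroupRing k H)} (hI : IsColonReflexive I) :
    ∃ J : Ideal (semigroupRing k H), IsMonomialIdeal J ∧
      conductorIdeal (semigroupRing k H) ≤ J ∧ Nonempty (I ≃ₗ[semigroupRing k H] J) := by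
  have := h.pos
  have := h.a_lt
  have := h.b_lt
  have := h.d_lt
  have hR : ∀ {f : k⟦X⟧}, f ∈ I.toSeries → f ∈ semigroupRing k H :=
    fun hf => Ideal.mem_semigroupRing_of_mem_toSeries hf
  have hIc := hI.containsTail h.isConductorExponent
  by_cases H0 : ∃ g ∈ I.toSeries, coeff 0 g ≠ 0
  · obtain ⟨g, hg, hg0⟩ := H0
    refine h.exists_monomialIdeal_equiv_of_coeff hIc fun f hf m _ hne =>
      Ideal.X_pow_mem_toSeries_of_coeff_zero_ne_zero hg hg0 ?_
    by_contra hmH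
    exact hne (hR hf m hmH)
  push Not at H0
  by_cases Ha : ∃ g ∈ I.toSeries, coeff a g ≠ 0
  swap
  · push Not at Ha
    exact h.exists_monomialIdeal_equiv_of_coeff_a hIc H0 Ha
  obtain ⟨g, hg, hga⟩ := Ideal.exists_coeff_eq_one Ha
  rcases hcond with hi | hii
  · exact h.exists_monomialIdeal_equiv_of_d_mem hi hIc H0
      (h.X_pow_d_mem_of_isColonReflexive hi hI hg (H0 g hg) hga) hg hga
  by_cases hd : X ^ d ∈ I.toSeries
  · refine h.exists_monomialIdeal_equiv_of_b_mem hIc H0 (hI _ fun f hf => ?_) hd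
    have hg' : X ^ a + C (coeff b g) * X ^ b ∈ I.toSeries := by
      refine h.mem_of_coeff_eq hIc (sub_mem hg (Ideal.C_mul_mem_toSeries (coeff d g) hd))
        (add_mem (X_pow_mem_semigroupRing h.a_mem)
          (mul_mem (C_mem_semigroupRing _) (X_pow_mem_semigroupRing h.b_mem))) ?_ ?_ ?_ ?_ <;>
      simp only [map_sub, map_add, coeff_C_mul, coeff_X_pow, h.ne, if_true, if_false,
        H0 g hg, hga, mul_zero, mul_one, add_zero, zero_add, sub_self, sub_zero]
    exact h.mul_X_pow_mem h.b_mem fun i hi hic =>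
      h.coeff_eq_zero_of_mul_mem_ab hii (hf _ hd) (hf _ hg') i hi (by omega)
  by_cases Hb : ∃ g ∈ I.toSeries, coeff a g = 0 ∧ coeff b g ≠ 0
  · obtain ⟨g₂, hg₂, hg₂a, hg₂b⟩ := Hb
    have hg₂' : X ^ b + C ((coeff b g₂)⁻¹ * coeff d g₂) * X ^ d ∈ I.toSeries := by
      refine h.mem_of_coeff_eq hIc (Ideal.C_mul_mem_toSeries (coeff b g₂)⁻¹ hg₂)
        (add_mem (X_pow_mem_semigroupRing h.b_mem)
          (mul_mem (C_mem_semigroupRing _) (X_pow_mem_semigroupRing h.d_mem))) ?_ ?_ ?_ ?_ <;>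
      simp only [map_add, coeff_C_mul, coeff_X_pow, h.ne, if_true, if_false,
        H0 _ hg₂, hg₂a, mul_zero, mul_one, add_zero, zero_add, inv_mul_cancel₀ hg₂b]
    set y := (coeff b g₂)⁻¹ * coeff d g₂
    obtain ⟨x, hx⟩ : ∃ x, x = coeff d g - coeff b g * y := ⟨_, rfl⟩
    have hg₁' : X ^ a + C x * X ^ d ∈ I.toSeries := by
      refine h.mem_of_coeff_eq hIc (sub_mem hg (Ideal.C_mul_mem_toSeries (coeff b g) hg₂'))
        (add_mem (X_pow_mem_semigroupRing h.a_mem)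
          (mul_mem (C_mem_semigroupRing _) (X_pow_mem_semigroupRing h.d_mem))) ?_ ?_ ?_ ?_ <;>
      simp only [map_sub, map_add, coeff_C_mul, coeff_X_pow, h.ne, if_true, if_false,
        H0 g hg, hga, mul_zero, mul_one, add_zero, zero_add, sub_self, sub_zero]
      exact hx
    -- Outside the exceptional relation `x = -y ^ 2`, reflexivity would force `X ^ d ∈ I`.
    by_cases hxy : d + a = 2 * b → x + y ^ 2 ≠ 0
    · refine absurd (hI _ fun f hf => ?_) hd
      exact h.mul_X_pow_mem h.d_mem fun i hi hic =>
        h.coeff_eq_zero_of_mul_mem_ad_bd hii (hf _ hg₁') (hf _ hg₂') hxy i hi (by omega)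
    · push Not at hxy
      rw [eq_neg_of_add_eq_zero_left hxy.2] at hg₁'
      exact h.exists_monomialIdeal_equiv_of_arith hxy.1 hIc H0 hg₁' hg₂' hd
  · push Not at Hb
    refine exists_monomialIdeal_equiv_of_principal h.isConductorExponent hIc h.a_mem hg hga
      (h.X_pow_dvd (hR hg) (by omega) (H0 g hg) (Or.inl le_rfl) (Or.inl (by omega))
        (Or.inl (by omega))) fun f hf => ?_
    have hf' := sub_mem hf (Ideal.C_mul_mem_toSeries (coeff a f) hg)
    have ha' : coeff a (f - C (coeff a f) * g) = 0 := by
      rw [map_sub, coeff_C_mul, hga, mul_one, sub_self]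
    have hd' : coeff d (f - C (coeff a f) * g) = 0 := by
      by_contra hne
      exact hd (h.X_pow_d_mem hIc hf' (H0 _ hf') ha' (Hb _ hf' ha') hne)
    exact h.X_pow_dvd (hR hf') le_rfl (H0 _ hf') (Or.inr ha') (Or.inr (Hb _ hf' ha'))
      (Or.inr hd')

end IsFourGap

namespace IsFourGap

variable {a b d : ℕ}

/-! #### The ideals generated by `X ^ a + x X ^ b`, `X ^ d` and the conductor -/

/-- The element `a + d` of `H` exceeds `d`, so `a + d ≥ c`, and `b < c + a - d ≤ 2a`. Products of
two elements of the maximal ideal therefore do not reach position `b`. -/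
theorem lt_two_mul (h : IsFourGap H a b d c) (hi : b + d < c + a) : b < 2 * a := by
  have := h.pos
  have := h.a_lt
  have := h.b_lt
  have h2 := (h.mem_iff _).1 (H.add_mem h.a_mem h.a_mem)
  have h3 := (h.mem_iff _).1 (H.add_mem h.a_mem h.d_mem)
  omega

theorem coeff_mul_of_lt (h : IsFourGap H a b d c) (hi : b + d < c + a) {r f : k⟦X⟧}
    (hr : r ∈ semigroupRing k H) (hf : f ∈ semigroupRing k H) (hf0 : coeff 0 f = 0) {m : ℕ}
    (hm : m ≤ b) : coeff m (r * f) = coeff 0 r * coeff m f := by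
  have := h.pos
  have := h.a_lt
  have := h.b_lt
  have := h.d_lt
  have h2 := h.lt_two_mul hi
  have hdvd : X ^ (a + a) ∣ (r - C (coeff 0 r)) * f := by
    rw [pow_add]
    refine mul_dvd_mul
      (h.X_pow_dvd (sub_mem hr (C_mem_semigroupRing _)) (by omega) ?_ (Or.inl le_rfl)
        (Or.inl (by omega)) (Or.inl (by omega)))
      (h.X_pow_dvd hf (by omega) hf0 (Or.inl le_rfl) (Or.inl (by omega)) (Or.inl (by omega)))
    rw [map_sub, coeff_C, if_pos rfl, sub_self]
  have := X_pow_dvd_iff.1 hdvd m (by omega)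
  rwa [sub_mul, map_sub, coeff_C_mul, sub_eq_zero] at this

/-- The ideal of all `f ∈ k⟦H⟧` with `f_0 = 0` and `f_b = x f_a`. -/
noncomputable def slantIdeal (h : IsFourGap H a b d c) (hi : b + d < c + a) (x : k) :
    Ideal (semigroupRing k H) where
  carrier := {f | coeff 0 (f : k⟦X⟧) = 0 ∧ coeff b (f : k⟦X⟧) = x * coeff a (f : k⟦X⟧)}
  add_mem' := by
    rintro f g ⟨hf, hf'⟩ ⟨hg, hg'⟩
    exact ⟨by simp only [AddMemClass.coe_add, map_add, hf, hg, add_zero],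
      by simp only [AddMemClass.coe_add, map_add, hf', hg', mul_add]⟩
  zero_mem' := by simp
  smul_mem' := by
    rintro r f ⟨hf, hf'⟩
    have hab := h.a_lt
    refine ⟨?_, ?_⟩ <;> rw [smul_eq_mul, MulMemClass.coe_mul]
    · rw [h.coeff_mul_of_lt hi r.2 f.2 hf (Nat.zero_le b), hf, mul_zero]
    · rw [h.coeff_mul_of_lt hi r.2 f.2 hf le_rfl, h.coeff_mul_of_lt hi r.2 f.2 hf hab.le, hf']
      ring

variable (h : IsFourGap H a b d c) (hi : b + d < c + a)

theorem mem_slantIdeal {x : k} {v : k⟦X⟧} : v ∈ (h.slantIdeal hi x).toSeries ↔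
    v ∈ semigroupRing k H ∧ coeff 0 v = 0 ∧ coeff b v = x * coeff a v := by
  rw [Ideal.mem_toSeries]
  exact ⟨fun ⟨hv, hv'⟩ => ⟨hv, hv'⟩, fun ⟨hv, hv'⟩ => ⟨hv, hv'⟩⟩

theorem X_pow_a_add_mem_slantIdeal (x : k) :
    X ^ a + C x * X ^ b ∈ (h.slantIdeal hi x).toSeries := by
  rw [mem_slantIdeal]
  refine ⟨add_mem (X_pow_mem_semigroupRing h.a_mem)
    (mul_mem (C_mem_semigroupRing _) (X_pow_mem_semigroupRing h.b_mem)), ?_, ?_⟩ <;>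
  simp only [map_add, coeff_C_mul, coeff_X_pow, h.ne, if_true, if_false, mul_zero, mul_one,
    add_zero, zero_add]

theorem X_pow_d_mem_slantIdeal (x : k) : X ^ d ∈ (h.slantIdeal hi x).toSeries := by
  rw [mem_slantIdeal]
  refine ⟨X_pow_mem_semigroupRing h.d_mem, ?_, ?_⟩ <;>
  simp only [coeff_X_pow, h.ne, if_false, mul_zero]

theorem slantIdeal_injective : Function.Injective (fun x : k => h.slantIdeal hi x) := by
  intro x y hxy
  have := h.X_pow_a_add_mem_slantIdeal hi x
  rw [show h.slantIdeal hi x = h.slantIdeal hi y from hxy, mem_slantIdeal] at this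
  simpa only [map_add, coeff_C_mul, coeff_X_pow, h.ne, if_true, if_false, mul_zero, mul_one,
    add_zero, zero_add] using this.2.2

theorem containsTail_slantIdeal (x : k) : ContainsTail c (h.slantIdeal hi x) := by
  intro v hv
  have := h.pos
  have := h.a_lt
  have := h.b_lt
  have := h.d_lt
  rw [mem_slantIdeal]
  refine ⟨h.isConductorExponent.mem_of_X_pow_dvd hv, X_pow_dvd_iff.1 hv 0 (by omega), ?_⟩
  rw [X_pow_dvd_iff.1 hv a (by omega), X_pow_dvd_iff.1 hv b (by omega), mul_zero]

theorem X_pow_dvd_sub_of_mem_slantIdeal {x : k} {y : k⟦X⟧}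
    (hy : y ∈ (h.slantIdeal hi x).toSeries) :
    X ^ c ∣ y - (C (coeff a y) * (X ^ a + C x * X ^ b) + C (coeff d y) * X ^ d) := by
  have hy' := sub_mem hy (add_mem
    (Ideal.C_mul_mem_toSeries (coeff a y) (h.X_pow_a_add_mem_slantIdeal hi x))
    (Ideal.C_mul_mem_toSeries (coeff d y) (h.X_pow_d_mem_slantIdeal hi x)))
  refine h.X_pow_dvd (Ideal.mem_semigroupRing_of_mem_toSeries hy') le_rfl
    ((h.mem_slantIdeal hi).1 hy').2.1 (Or.inr ?_) (Or.inr ?_) (Or.inr ?_) <;>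
  simp only [map_sub, map_add, coeff_C_mul, coeff_X_pow, h.ne, if_true, if_false, mul_zero,
    mul_one, add_zero, zero_add, sub_self]
  rw [((h.mem_slantIdeal hi).1 hy).2.2, mul_comm, sub_self]

/-- As `X ^ d` lies in the ideal and `d + (b - a)` is a gap, every multiplier has `f_(b-a) = 0`. So
`f` scales the coefficients at `a` and `b` by the same `f_0`, up to the tail and `X ^ d`. -/
theorem isColonStable_slantIdeal (x : k) : IsColonStable (h.slantIdeal hi x) := by
  intro f hf y hy
  have := h.pos
  have := h.a_lt
  have := h.b_lt
  have := h.d_lt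
  have hba : coeff (b - a) f = 0 := by
    have := hf _ (h.X_pow_d_mem_slantIdeal hi x) (d + (b - a))
      (h.notMem_of_lt (by omega) (by omega) (by omega) (by omega) (by omega))
    rwa [coeff_mul_X_pow', if_pos (by omega), Nat.add_sub_cancel_left] at this
  rw [mem_slantIdeal]
  refine ⟨hf y hy, ?_, ?_⟩
  · rw [coeff_zero_eq_constantCoeff_apply, map_mul, ← coeff_zero_eq_constantCoeff_apply y,
      ((h.mem_slantIdeal hi).1 hy).2.1, mul_zero]
  · have key : ∀ m, m ≤ b → coeff m (f * y) =
        coeff a y * coeff m (f * (X ^ a + C x * X ^ b)) := by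
      intro m hm
      have hsplit : f * y = C (coeff a y) * (f * (X ^ a + C x * X ^ b)) +
          C (coeff d y) * (f * X ^ d) + f * (y - (C (coeff a y) * (X ^ a + C x * X ^ b) +
            C (coeff d y) * X ^ d)) := by ring
      rw [hsplit, map_add, map_add, coeff_C_mul, coeff_C_mul, coeff_mul_X_pow',
        if_neg (by omega), X_pow_dvd_iff.1
          ((h.X_pow_dvd_sub_of_mem_slantIdeal hi hy).mul_left f) m (by omega), mul_zero, add_zero,
        add_zero]
    rw [key b le_rfl, key a (by omega), PowerSeries.coeff_mul_X_pow_add,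
      PowerSeries.coeff_mul_X_pow_add, if_pos (by omega), if_pos le_rfl, if_pos le_rfl,
      if_neg (by omega), Nat.sub_self, Nat.sub_self, hba]
    ring

theorem slantIdeal_mem_regularTraceIdeals (x : k) :
    h.slantIdeal hi x ∈ regularTraceIdeals (semigroupRing k H) :=
  (h.containsTail_slantIdeal hi x).mem_regularTraceIdeals h.isConductorExponent
    (h.isColonStable_slantIdeal hi x)

/-- One multiplier suffices besides `1`: for `w = 1 + x X ^ (b - a)`, the series `X ^ (d - a) / w`
sends `X ^ a + x X ^ b` to `X ^ d`, and `X ^ d` into the tail because `2d - a ≥ c`. Its product with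
`g` must vanish at the gaps, which yields `g_0 = 0` and `g_b = x g_a`. -/
theorem isColonReflexive_slantIdeal (hii : c + a ≤ 2 * d) (x : k) :
    IsColonReflexive (h.slantIdeal hi x) := by
  intro g hg
  have := h.pos
  have := h.a_lt
  have := h.b_lt
  have := h.d_lt
  have hc := h.isConductorExponent
  -- Writing `1` as `X ^ 0` makes `PowerSeries.coeff_mul_X_pow_add` applicable with `e = 0`.
  obtain ⟨w, hw⟩ : ∃ w : k⟦X⟧, w = X ^ 0 + C x * X ^ (b - a) := ⟨_, rfl⟩
  have hw0 : coeff 0 w = 1 := by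
    rw [hw, map_add, coeff_C_mul, coeff_X_pow, coeff_X_pow, if_pos rfl, if_neg (by omega),
      mul_zero, add_zero]
  obtain ⟨u, hu⟩ := PowerSeries.exists_mul_eq_one (g := w) (by rw [hw0]; exact one_ne_zero)
  have hXb : X ^ (b - a) * X ^ a = (X ^ b : k⟦X⟧) := by
    rw [← pow_add, Nat.sub_add_cancel (by omega)]
  have hXd : X ^ (d - a) * X ^ a = (X ^ d : k⟦X⟧) := by
    rw [← pow_add, Nat.sub_add_cancel (by omega)]
  have hgR : g ∈ semigroupRing k H := by
    have := hg 1 fun y hy => by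
      rw [one_mul]
      exact Ideal.mem_semigroupRing_of_mem_toSeries hy
    rwa [one_mul] at this
  have hr : X ^ (d - a) * u * g ∈ semigroupRing k H := by
    refine hg _ fun y hy => ?_
    obtain ⟨t, ht⟩ := h.X_pow_dvd_sub_of_mem_slantIdeal hi hy
    have hsplit : X ^ (d - a) * u * y = C (coeff a y) * X ^ d +
        (X ^ (d - a) * X ^ d * (C (coeff d y) * u) + X ^ c * (t * X ^ (d - a) * u)) := by
      linear_combination X ^ (d - a) * u * ht + C (coeff a y) * X ^ d * hu +
        C (coeff a y) * hXd * u * w - C (coeff a y) * X ^ (d - a) * X ^ a * u * hw -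
        C (coeff a y) * X ^ (d - a) * u * C x * hXb
    rw [hsplit]
    refine add_mem (mul_mem (C_mem_semigroupRing _) (X_pow_mem_semigroupRing h.d_mem))
      (hc.mem_of_X_pow_dvd (dvd_add (Dvd.dvd.mul_right ?_ _) (dvd_mul_right _ _)))
    rw [← pow_add]
    exact pow_dvd_pow _ (by omega)
  set r := X ^ (d - a) * u * g with hr_def
  have hrel : ∀ m, coeff m r + x * (if b - a ≤ m then coeff (m - (b - a)) r else 0) =
      if d - a ≤ m then coeff (m - (d - a)) g else 0 := by
    intro m
    have hwr : r * (X ^ 0 + C x * X ^ (b - a)) = X ^ (d - a) * g := by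
      rw [← hw, hr_def]
      linear_combination X ^ (d - a) * g * hu
    have := congrArg (coeff m) hwr
    rwa [PowerSeries.coeff_mul_X_pow_add, if_pos (Nat.zero_le m), Nat.sub_zero,
      coeff_X_pow_mul'] at this
  have hg0 : coeff 0 g = 0 := by
    have hm := hrel (d - a)
    have h2 := (h.mem_iff (d - a + b))
    -- Otherwise `d - a + b`, strictly between `d` and `c`, would lie in `H`.
    have hda : d - a ∉ H := fun hda => by
      have := (h.mem_iff _).1 (H.add_mem hda h.b_mem)
      omega
    rw [hr _ hda, if_pos (by omega), if_pos le_rfl, Nat.sub_self,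
      X_pow_dvd_iff.1 (show X ^ (d - a) ∣ r from ⟨u * g, by rw [hr_def, mul_assoc]⟩)
        (d - a - (b - a)) (by omega), mul_zero, add_zero] at hm
    exact hm.symm
  have hrd : X ^ d ∣ r := by
    obtain ⟨q, hq⟩ := h.X_pow_dvd hgR (n := a) (by omega) hg0 (Or.inl le_rfl) (Or.inl (by omega))
      (Or.inl (by omega))
    exact ⟨u * q, by rw [hr_def, hq, ← hXd]; ring⟩
  rw [mem_slantIdeal]
  refine ⟨hgR, hg0, ?_⟩
  have h1 := hrel d
  have h2 := hrel (d + (b - a))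
  rw [if_pos (by omega), if_pos (by omega), X_pow_dvd_iff.1 hrd (d - (b - a)) (by omega), mul_zero,
    add_zero, show d - (d - a) = a by omega] at h1
  rw [if_pos (by omega), if_pos (by omega), show d + (b - a) - (d - a) = b by omega,
    Nat.add_sub_cancel, h1,
    hr _ (h.notMem_of_lt (by omega) (by omega) (by omega) (by omega) (by omega)), zero_add] at h2
  exact h2.symm

theorem infinite_regularTraceIdeals [Infinite k] (h : IsFourGap H a b d c) (hi : b + d < c + a) :
    (regularTraceIdeals (semigroupRing k H)).Infinite :=
  Set.infinite_of_injective_forall_mem (h.slantIdeal_injective hi)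
    (h.slantIdeal_mem_regularTraceIdeals hi)

theorem infinite_reflexiveTraceIdeals [Infinite k] (h : IsFourGap H a b d c) (hi : b + d < c + a)
    (hii : c + a ≤ 2 * d) :
    (reflexiveTraceIdeals (semigroupRing k H)).Infinite :=
  Set.infinite_of_injective_forall_mem (h.slantIdeal_injective hi) fun x =>
    ⟨h.slantIdeal_mem_regularTraceIdeals hi x,
      (h.isColonReflexive_slantIdeal hi hii x).isReflexiveIdeal h.isConductorExponent⟩

end IsFourGap

/-! ### From the index of the semigroup to the theorem -/

theorem isFourGap_of_semigroupIndex (hH : ((H : Set ℕ)ᶜ).Finite) (hn : semigroupIndex H = 4) :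
    IsFourGap H (semigroupElt H 1) (semigroupElt H 2) (semigroupElt H 3) (semigroupElt H 4) := by
  have hinf : (H : Set ℕ).Infinite := Set.infinite_of_finite_compl hH
  have hmono : StrictMono (semigroupElt H) := Nat.nth_strictMono hinf
  have hne : {n : ℕ | ∀ i : ℕ, semigroupElt H (n + i) = semigroupElt H n + i}.Nonempty := by
    -- The infimum of the empty set is `0` by convention, not `4`.
    by_contra hemp
    rw [Set.not_nonempty_iff_eq_empty] at hemp
    rw [semigroupIndex, hemp, Nat.sInf_empty] at hn
    omega
  have h4 : ∀ i, semigroupElt H (4 + i) = semigroupElt H 4 + i := by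
    have := Nat.sInf_mem hne
    rw [semigroupIndex] at hn
    rwa [hn] at this
  have h3 : ¬ ∀ i, semigroupElt H (3 + i) = semigroupElt H 3 + i := fun h3 => by
    have : sInf {n : ℕ | ∀ i : ℕ, semigroupElt H (n + i) = semigroupElt H n + i} ≤ 3 :=
      Nat.sInf_le h3
    rw [semigroupIndex] at hn
    omega
  have h0 : semigroupElt H 0 = 0 := Nat.nth_zero_of_zero H.zero_mem
  have h01 := hmono (show 0 < 1 by omega)
  have h12 := hmono (show 1 < 2 by omega)
  have h23 := hmono (show 2 < 3 by omega)
  have h34 := hmono (show 3 < 4 by omega)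
  have hmem : ∀ m, m ∈ H ↔ ∃ i, semigroupElt H i = m := fun m => by
    have := Nat.range_nth_of_infinite hinf
    exact (Set.ext_iff.1 this m).symm
  refine ⟨by omega, h12, h23, ?_, fun m => (hmem m).trans ⟨?_, ?_⟩⟩
  -- If `c = d + 1`, the final run of consecutive elements would already start at `d`, and the index
  -- would be at most `3`.
  · by_contra hcon
    apply h3
    intro i
    rcases i with _ | i
    · rfl
    · rw [show 3 + (i + 1) = 4 + i by omega, h4]
      omega
  · rintro ⟨i, rfl⟩
    rcases i with _ | _ | _ | _ | i
    · exact Or.inl h0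
    · exact Or.inr (Or.inl rfl)
    · exact Or.inr (Or.inr (Or.inl rfl))
    · exact Or.inr (Or.inr (Or.inr (Or.inl rfl)))
    · exact Or.inr (Or.inr (Or.inr (Or.inr (hmono.monotone (by omega)))))
  · rintro (rfl | rfl | rfl | rfl | hm)
    · exact ⟨0, h0⟩
    · exact ⟨1, rfl⟩
    · exact ⟨2, rfl⟩
    · exact ⟨3, rfl⟩
    · exact ⟨4 + (m - semigroupElt H 4), by rw [h4]; omega⟩

theorem mainTheorem3 {k : Type u} [Field k] [Infinite k] (H : AddSubmonoid ℕ)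
    (hH : ((H : Set ℕ)ᶜ).Finite) (hn : semigroupIndex H = 4) :
    List.TFAE [
      ∀ (M : Type u) [AddCommGroup M] [Module (semigroupRing k H) M],
        IsRankOneReflexive (semigroupRing k H) M →
          ∃ I : Ideal (semigroupRing k H), IsMonomialIdeal I ∧
            conductorIdeal (semigroupRing k H) ≤ I ∧ Nonempty (M ≃ₗ[semigroupRing k H] I),
      (rankOneReflexiveClasses (semigroupRing k H)).Finite,
      (reflexiveTraceIdeals (semigroupRing k H)).Finite,
      (semigroupElt H 2 : ℤ) - semigroupElt H 1 + semigroupElt H 3 ≥ semigroupElt H 4 ∨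
        2 * (semigroupElt H 3 : ℤ) - semigroupElt H 1 < semigroupElt H 4] ∧
    ((semigroupElt H 2 : ℤ) - semigroupElt H 1 + semigroupElt H 3 ≥ semigroupElt H 4 ↔
      (regularTraceIdeals (semigroupRing k H)).Finite) := by

  have h := isFourGap_of_semigroupIndex hH hn
  have hc := h.isConductorExponent
  refine ⟨?_, fun hi => h.finite_regularTraceIdeals (by omega), fun hfin => ?_⟩
  · tfae_have 1 → 2 := fun h1 => finite_rankOneReflexiveClasses hc h1
    tfae_have 2 → 3 := finite_reflexiveTraceIdeals
    tfae_have 3 → 4 := fun hfin => by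
      by_contra hcon
      exact h.infinite_reflexiveTraceIdeals (k := k) (by omega) (by omega) hfin
    tfae_have 4 → 1 := fun hcond M _ _ hM => by
      obtain ⟨I, ⟨e⟩, hI⟩ := exists_ideal_of_isRankOneReflexive M hM
      obtain ⟨J, hJ, hJc, ⟨e'⟩⟩ :=
        h.exists_monomialIdeal_equiv_of_isColonReflexive (by omega) hI
      exact ⟨J, hJ, hJc, ⟨e.trans e'⟩⟩
    tfae_finish
  · by_contra hcon
    exact h.infinite_regularTraceIdeals (k := k) (by omega) hfin
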